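/- **Languages and axioms.** Let $L_0=\langle <,Z;S,P,\pi;c_1,c_2,c_3,c_4\rangle$ with $<$ a binary relation symbol, $Z$ a unary predicate, $S,P,\pi$ unary function symbols and $c_1,\dots,c_4$ constant symbols, and let $L_1=L_0\cup\{f,g\}$ with $f,g$ unary function symbols. Write $C_<(a,b,c)$ for $(a<b<c)\lor(b<c<a)\lor(c<a<b)$. An $L_0$-structure is *o-minimal* if $<$ is a dense linear order without endpoints and every subset of the universe definable with parameters is a finite union of points and open intervals with endpoints in the universe or $\pm\infty$. $T_0$ is the $L_0$-theory with the following axioms: - every $L_0$-sentence that is true in all o-minimal $L_0$-structures; - $<$ is a dense linear order without endpoints; - every non-maximal (non-minimal) element of $Z$ has an immediate successor (predecessor) in $Z$; every $x\notin Z$ lies in an open interval disjoint from $Z$; $\min Z=c_1$, $\max Z=c_4$; - $c_2,c_3\in Z$, $c_1<c_2<c_3<c_4$, and there are infinitely many elements of $Z$ between any two of the $c_i$; - $\pi$ is the cyclic forward projection on $Z$: for all $x$, $\pi(x)\in Z$ and there is no $y\in Z$ with $C_<(x,y,\pi(x))$; and $\pi(x)=x$ for $x\in Z$; - $S$ is the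 cyclic successor on $Z$ and the identity outside $Z$: $S(x)=y$ iff either $x\notin Z$ and $x=y$, or $x,y\in Z$, $x\ne y$ and there is no $z\in Z$ with $C_<(x,z,y)$; and $P=S^{-1}$. $T_1$ is the $L_1$-theory consisting of $T_0$ and the following axioms: - $f$ is bijective, $g=f^{-1}$, and $f(x)=x$ for $x\notin Z$; - $f$ restricts to order isomorphisms from $Z\cap[c_1,c_2]$ onto $Z\cap[c_3,c_4]$ and from $Z\cap(c_2,c_4]$ onto $Z\cap[c_1,c_3)$; - for all $n>1$ and $z\in Z$ the sets $\{y\in Z: C_<(z,y,f^n(z))\}$ and $\{y\in Z: C_<(f^n(z),y,z)\}$ are infinite; - $C_<(f^m(z),f^n(z),z)$ for all $m>n>0$ and $z\in Z$. **The modified structure.** Let $\mathcal M_1$ be any model of $T_1$, with universe $M$. Let $\mathcal M_2$ be the $L_1$-structure with the same universe and the same $L_0$-reduct as $\mathcal M_1$, and with $$f^{\mathcal M_2}(x)=\begin{cases}P(f^{\mathcal M_1}(x)) & \text{if } S^n(x)=c_4\text{ for some } n\in\mathbb N,\\ f^{\mathcal M_1}(x)&\text{otherwise,}\end{cases}\qquad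 g^{\mathcal M_2}(x)=\begin{cases}g^{\mathcal M_1}(S(x)) & \text{if } S^n(x)=P(c_3)\text{ for some } n\in\mathbb N,\\ g^{\mathcal M_1}(x)&\text{otherwise.}\end{cases}$$ Let $T_2$ be the complete $L_1$-theory of $\mathcal M_2$. **Theorem.** $T_2$ admits quantifier elimination: every $L_1$-formula is equivalent, modulo $T_2$, to a quantifier-free $L_1$-formula in the same free variables. Moreover $f^{\mathcal M_2}$ maps $Z$ into $Z$, and as a map $Z\to Z$ it is injective but not surjective. -/

import Mathlib

open scoped FirstOrder

universe u

namespace PseudoOMin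

/-! ### The languages `L₀ = ⟨<, Z; S, P, π; c₁, c₂, c₃, c₄⟩` and `L₁ = L₀ ∪ {f, g}` -/

/-- Function symbols of `L₀`: four constants and three unary functions. -/
inductive Func₀ : ℕ → Type
  | c₁ : Func₀ 0
  | c₂ : Func₀ 0
  | c₃ : Func₀ 0
  | c₄ : Func₀ 0
  | S : Func₀ 1
  | P : Func₀ 1
  | π : Func₀ 1

/-- Relation symbols of `L₀`: the unary predicate `Z` and the (strict) order `<`. -/
inductive Rel₀ : ℕ → Type
  | Z : Rel₀ 1
  | lt : Rel₀ 2

/-- The two additional unary function symbols. -/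
inductive FuncFG : ℕ → Type
  | f : FuncFG 1
  | g : FuncFG 1

/-- The language `L₀`. -/
abbrev L₀ : FirstOrder.Language.{0, 0} := ⟨Func₀, Rel₀⟩

/-- The language with the function symbols `f`, `g` only. -/
abbrev LFG : FirstOrder.Language.{0, 0} := ⟨FuncFG, fun _ => Empty⟩

/-- The language `L₁ = L₀ ∪ {f, g}`. -/
abbrev L₁ : FirstOrder.Language.{0, 0} := L₀.sum LFG

/-! ### Interpretations of the symbols in a structure -/

section Zero

variable {M : Type u} (𝓜 : L₀.Structure M)

/-- The interpretation of `<`. -/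
def lt (x y : M) : Prop := 𝓜.RelMap Rel₀.lt ![x, y]

/-- `x ≤ y`, that is, `x < y` or `x = y`. -/
def le (x y : M) : Prop := lt 𝓜 x y ∨ x = y

/-- The interpretation of the predicate `Z`, as a set. -/
def Z : Set M := {x | 𝓜.RelMap Rel₀.Z ![x]}

/-- The interpretation of `S`. -/
def S (x : M) : M := 𝓜.funMap Func₀.S ![x]

/-- The interpretation of `P`. -/
def P (x : M) : M := 𝓜.funMap Func₀.P ![x]

/-- The interpretation of `π`. -/
def π (x : M) : M := 𝓜.funMap Func₀.π ![x]

/-- The interpretation of `c₁`. -/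
def c₁ : M := 𝓜.funMap Func₀.c₁ ![]

/-- The interpretation of `c₂`. -/
def c₂ : M := 𝓜.funMap Func₀.c₂ ![]

/-- The interpretation of `c₃`. -/
def c₃ : M := 𝓜.funMap Func₀.c₃ ![]

/-- The interpretation of `c₄`. -/
def c₄ : M := 𝓜.funMap Func₀.c₄ ![]

/-- The cyclic order `C_<` induced by `<`. -/
def cyc (a b c : M) : Prop :=
  (lt 𝓜 a b ∧ lt 𝓜 b c) ∨ (lt 𝓜 b c ∧ lt 𝓜 c a) ∨ (lt 𝓜 c a ∧ lt 𝓜 a b)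

/-- `<` is a dense linear order without endpoints. -/
structure IsDLO : Prop where
  irrefl : ∀ x, ¬ lt 𝓜 x x
  trans : ∀ x y z, lt 𝓜 x y → lt 𝓜 y z → lt 𝓜 x z
  total : ∀ x y, lt 𝓜 x y ∨ x = y ∨ lt 𝓜 y x
  dense : ∀ x y, lt 𝓜 x y → ∃ z, lt 𝓜 x z ∧ lt 𝓜 z y
  no_min : ∀ x, ∃ y, lt 𝓜 y x
  no_max : ∀ x, ∃ y, lt 𝓜 x y

/-- A point, or an open interval with endpoints in `M ∪ {-∞, +∞}`. -/
def IsPointOrInterval (I : Set M) : Prop :=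
  (∃ a, I = {a}) ∨
  I = Set.univ ∨
  (∃ a, I = {x | lt 𝓜 x a}) ∨
  (∃ a, I = {x | lt 𝓜 a x}) ∨
  (∃ a b, I = {x | lt 𝓜 a x ∧ lt 𝓜 x b})

/-- An `L₀`-structure is o-minimal if `<` is a dense linear order without endpoints and every
subset of the universe that is definable with parameters is a finite union of points and open
intervals. -/
structure IsOMinimal : Prop where
  dlo : IsDLO 𝓜
  definable : ∀ X : Set M, (Set.univ : Set M).Definable₁ L₀ X →
    ∃ F : Set (Set M), F.Finite ∧ (∀ I ∈ F, IsPointOrInterval 𝓜 I) ∧ X = ⋃₀ F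

end Zero

/-- The common theory `T^omin` of all o-minimal `L₀`-structures. (The language is countable and
elementary substructures of o-minimal structures are o-minimal, so by Löwenheim–Skolem the
structures with universe in `Type` already determine this theory.) -/
def Tomin : L₀.Theory :=
  {σ | ∀ (N : Type) (𝓝 : L₀.Structure N), IsOMinimal 𝓝 →
    @FirstOrder.Language.Sentence.Realize L₀ N 𝓝 σ}

/-- `𝓜 ⊨ T₀`: the `L₀`-structure `𝓜` satisfies the axioms of `T₀`. -/
structure ModelsT₀ {M : Type u} (𝓜 : L₀.Structure M) : Prop where
  /-- Axiom scheme: `𝓜` satisfies the common theory of o-minimal `L₀`-structures. -/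
  omin : @FirstOrder.Language.Theory.Model L₀ M 𝓜 Tomin
  dlo : IsDLO 𝓜
  /-- Every non-maximal element of `Z` has an immediate successor in `Z`. -/
  discrete_succ : ∀ x ∈ Z 𝓜, (∃ w ∈ Z 𝓜, lt 𝓜 x w) →
    ∃ y ∈ Z 𝓜, lt 𝓜 x y ∧ ∀ z ∈ Z 𝓜, ¬ (lt 𝓜 x z ∧ lt 𝓜 z y)
  /-- Every non-minimal element of `Z` has an immediate predecessor in `Z`. -/
  discrete_pred : ∀ x ∈ Z 𝓜, (∃ w ∈ Z 𝓜, lt 𝓜 w x) →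
    ∃ y ∈ Z 𝓜, lt 𝓜 y x ∧ ∀ z ∈ Z 𝓜, ¬ (lt 𝓜 y z ∧ lt 𝓜 z x)
  /-- `Z` is closed. -/
  closed : ∀ x, x ∉ Z 𝓜 →
    ∃ a b, lt 𝓜 a x ∧ lt 𝓜 x b ∧ ∀ z, lt 𝓜 a z → lt 𝓜 z b → z ∉ Z 𝓜
  /-- `c₁ = min Z`. -/
  c₁_mem : c₁ 𝓜 ∈ Z 𝓜
  c₁_le : ∀ z ∈ Z 𝓜, le 𝓜 (c₁ 𝓜) z
  /-- `c₄ = max Z`. -/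
  c₄_mem : c₄ 𝓜 ∈ Z 𝓜
  le_c₄ : ∀ z ∈ Z 𝓜, le 𝓜 z (c₄ 𝓜)
  c₂_mem : c₂ 𝓜 ∈ Z 𝓜
  c₃_mem : c₃ 𝓜 ∈ Z 𝓜
  /-- `c₁ < c₂ < c₃ < c₄`, with infinitely many elements of `Z` between any two of them. -/
  c₁_lt_c₂ : lt 𝓜 (c₁ 𝓜) (c₂ 𝓜)
  c₂_lt_c₃ : lt 𝓜 (c₂ 𝓜) (c₃ 𝓜)
  c₃_lt_c₄ : lt 𝓜 (c₃ 𝓜) (c₄ 𝓜)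
  infinite₁₂ : {z ∈ Z 𝓜 | lt 𝓜 (c₁ 𝓜) z ∧ lt 𝓜 z (c₂ 𝓜)}.Infinite
  infinite₂₃ : {z ∈ Z 𝓜 | lt 𝓜 (c₂ 𝓜) z ∧ lt 𝓜 z (c₃ 𝓜)}.Infinite
  infinite₃₄ : {z ∈ Z 𝓜 | lt 𝓜 (c₃ 𝓜) z ∧ lt 𝓜 z (c₄ 𝓜)}.Infinite
  /-- `π` is the cyclic forward projection on `Z`; it fixes the points of `Z`. -/
  π_mem : ∀ x, π 𝓜 x ∈ Z 𝓜
  π_between : ∀ x, ∀ y ∈ Z 𝓜, ¬ cyc 𝓜 x y (π 𝓜 x)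
  π_of_mem : ∀ x ∈ Z 𝓜, π 𝓜 x = x
  /-- `S` is the cyclic successor function on `Z`, and the identity outside of `Z`. -/
  S_eq_iff : ∀ x y, S 𝓜 x = y ↔
    (x ∉ Z 𝓜 ∧ x = y) ∨
    (x ∈ Z 𝓜 ∧ y ∈ Z 𝓜 ∧ x ≠ y ∧ ¬ ∃ z ∈ Z 𝓜, cyc 𝓜 x z y)
  /-- `P` is the inverse of `S`. -/
  P_S : ∀ x, P 𝓜 (S 𝓜 x) = x
  S_P : ∀ x, S 𝓜 (P 𝓜 x) = x

/-- The reduct of an `L₁`-structure to `L₀`. -/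
abbrev reduct₀ {M : Type u} (𝓜 : L₁.Structure M) : L₀.Structure M :=
  @FirstOrder.Language.LHom.reduct L₀ L₁ FirstOrder.Language.LHom.sumInl M 𝓜

section One

variable {M : Type u} (𝓜 : L₁.Structure M)

/-- The interpretation of `f`. -/
def f (x : M) : M := 𝓜.funMap (Sum.inr FuncFG.f : L₁.Functions 1) ![x]

/-- The interpretation of `g`. -/
def g (x : M) : M := 𝓜.funMap (Sum.inr FuncFG.g : L₁.Functions 1) ![x]

/-- `Z ∩ [a, b]`. -/
def Zcc (a b : M) : Set M :=
  {z ∈ Z (reduct₀ 𝓜) | le (reduct₀ 𝓜) a z ∧ le (reduct₀ 𝓜) z b}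

/-- `Z ∩ (a, b]`. -/
def Zoc (a b : M) : Set M :=
  {z ∈ Z (reduct₀ 𝓜) | lt (reduct₀ 𝓜) a z ∧ le (reduct₀ 𝓜) z b}

/-- `Z ∩ [a, b)`. -/
def Zco (a b : M) : Set M :=
  {z ∈ Z (reduct₀ 𝓜) | le (reduct₀ 𝓜) a z ∧ lt (reduct₀ 𝓜) z b}

/-- `𝓜 ⊨ T₁`: the `L₁`-structure `𝓜` satisfies the axioms of `T₁`. -/
structure ModelsT₁ : Prop where
  models₀ : ModelsT₀ (reduct₀ 𝓜)
  /-- `f` is bijective and `g = f⁻¹`. -/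
  bijective : Function.Bijective (f 𝓜)
  g_f : ∀ x, g 𝓜 (f 𝓜 x) = x
  f_g : ∀ x, f 𝓜 (g 𝓜 x) = x
  /-- `f` maps `Z ∩ [c₁, c₂]` isomorphically onto `Z ∩ [c₃, c₄]`. -/
  image₁₂ : f 𝓜 '' Zcc 𝓜 (c₁ (reduct₀ 𝓜)) (c₂ (reduct₀ 𝓜)) =
    Zcc 𝓜 (c₃ (reduct₀ 𝓜)) (c₄ (reduct₀ 𝓜))
  iso₁₂ : ∀ x ∈ Zcc 𝓜 (c₁ (reduct₀ 𝓜)) (c₂ (reduct₀ 𝓜)),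
    ∀ y ∈ Zcc 𝓜 (c₁ (reduct₀ 𝓜)) (c₂ (reduct₀ 𝓜)),
      (lt (reduct₀ 𝓜) x y ↔ lt (reduct₀ 𝓜) (f 𝓜 x) (f 𝓜 y))
  /-- `f` maps `Z ∩ (c₂, c₄]` isomorphically onto `Z ∩ [c₁, c₃)`. -/
  image₂₄ : f 𝓜 '' Zoc 𝓜 (c₂ (reduct₀ 𝓜)) (c₄ (reduct₀ 𝓜)) =
    Zco 𝓜 (c₁ (reduct₀ 𝓜)) (c₃ (reduct₀ 𝓜))
  iso₂₄ : ∀ x ∈ Zoc 𝓜 (c₂ (reduct₀ 𝓜)) (c₄ (reduct₀ 𝓜)),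
    ∀ y ∈ Zoc 𝓜 (c₂ (reduct₀ 𝓜)) (c₄ (reduct₀ 𝓜)),
      (lt (reduct₀ 𝓜) x y ↔ lt (reduct₀ 𝓜) (f 𝓜 x) (f 𝓜 y))
  /-- For `n > 1` and `z ∈ Z`, both arcs of `Z` between `z` and `fⁿ(z)` are infinite. -/
  infinite_forward : ∀ n : ℕ, 1 < n → ∀ z ∈ Z (reduct₀ 𝓜),
    {y ∈ Z (reduct₀ 𝓜) | cyc (reduct₀ 𝓜) z y ((f 𝓜)^[n] z)}.Infinite
  infinite_backward : ∀ n : ℕ, 1 < n → ∀ z ∈ Z (reduct₀ 𝓜),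
    {y ∈ Z (reduct₀ 𝓜) | cyc (reduct₀ 𝓜) ((f 𝓜)^[n] z) y z}.Infinite
  /-- `f` is the identity outside of `Z`. -/
  f_of_not_mem : ∀ x, x ∉ Z (reduct₀ 𝓜) → f 𝓜 x = x
  /-- `C_<(f^m(z), f^n(z), z)` for `m > n > 0` and `z ∈ Z`. -/
  circular : ∀ m n : ℕ, n < m → 0 < n → ∀ z ∈ Z (reduct₀ 𝓜),
    cyc (reduct₀ 𝓜) ((f 𝓜)^[m] z) ((f 𝓜)^[n] z) z

/-! ### The modified structure and its theory -/

open scoped Classical in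
/-- The modification of `f`: it is `P ∘ f` at the points `x` with `Sⁿ(x) = c₄` for some `n`,
and `f` elsewhere. -/
noncomputable def f₂ (x : M) : M :=
  if ∃ n : ℕ, (S (reduct₀ 𝓜))^[n] x = c₄ (reduct₀ 𝓜) then P (reduct₀ 𝓜) (f 𝓜 x) else f 𝓜 x

open scoped Classical in
/-- The modification of `g`: it is `g ∘ S` at the points `x` with `Sⁿ(x) = P(c₃)` for some `n`,
and `g` elsewhere. -/
noncomputable def g₂ (x : M) : M :=
  if ∃ n : ℕ, (S (reduct₀ 𝓜))^[n] x = P (reduct₀ 𝓜) (c₃ (reduct₀ 𝓜))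
  then g 𝓜 (S (reduct₀ 𝓜) x) else g 𝓜 x

/-- The structure `𝓜₂`: the `L₁`-structure with the same universe and the same `L₀`-reduct as
`𝓜`, in which `f` and `g` are interpreted by `f₂` and `g₂`. -/
noncomputable abbrev modified : L₁.Structure M where
  funMap := fun {n} F => match n, F with
    | _, Sum.inl F => fun v => 𝓜.funMap (Sum.inl F : L₁.Functions _) v
    | _, Sum.inr FuncFG.f => fun v => f₂ 𝓜 (v 0)
    | _, Sum.inr FuncFG.g => fun v => g₂ 𝓜 (v 0)
  RelMap := fun R v => 𝓜.RelMap R v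

/-- The theory `T₂`: the complete theory of the structure `𝓜₂`. -/
def T₂ : L₁.Theory := @FirstOrder.Language.completeTheory L₁ M (modified 𝓜)

end One

/-- A theory admits quantifier elimination if, modulo the theory, every formula is equivalent to
a quantifier-free formula in the same free variables. -/
def AdmitsQE {L : FirstOrder.Language.{0, 0}} (T : L.Theory) : Prop :=
  ∀ (n : ℕ) (φ : L.Formula (Fin n)), ∃ ψ : L.Formula (Fin n),
    FirstOrder.Language.BoundedFormula.IsQF ψ ∧ T ⊨ᵇ FirstOrder.Language.BoundedFormula.iff φ ψ

/-! ### Sanity checks for the modified structure -/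

theorem reduct₀_modified {M : Type u} (𝓜 : L₁.Structure M) :
    reduct₀ (modified 𝓜) = reduct₀ 𝓜 := rfl

theorem f_modified {M : Type u} (𝓜 : L₁.Structure M) : f (modified 𝓜) = f₂ 𝓜 := rfl

theorem g_modified {M : Type u} (𝓜 : L₁.Structure M) : g (modified 𝓜) = g₂ 𝓜 := rfl

end PseudoOMin

universe v

/-! The theory of `modified 𝓜₁` admits elimination because tuples with the same quantifier-free
type, in any two models, have the same type. By compactness this suffices (`admitsQE_of_realize`).
It is proved by back-and-forth between substructures, with the codomain replaced by an elementary
extension whenever a cut has to be realized.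

Only a few first-order facts about the models matter (`RotationData.IsDefective`, over a dense
order). `Z` is discrete. On `Z`, `f` sends the part up to `c₂` above the part beyond `c₂`, is
increasing on each part, and misses just `P c₃`. It commutes with `S` except at `c₄`. Its iterates
turn in a fixed cyclic sense and never bring a point to finite distance from itself.

The substructure `D` on which a partial isomorphism is defined contains the exceptional points `c₄`
and `P c₃`. Hence `S` and `f` restrict to commuting permutations of `Z` outside `D`, although `f` is
not surjective on `Z`. Adding `u ∈ Z` outside `D` adds its orbit under these permutations. The order
of the orbit relative to `D` reduces to the cut of `u`, since `S` and `f` can be moved across an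
inequality. The order inside the orbit also follows from this cut: finite shifts do not affect
comparisons between different `S`-chains, and by circularity the comparison of `u` with `f^n u`
depends only on which iterates lie below `c₂` (`IsClosed.lt_rot_pow_iff`). Thus the cut determines
the isomorphism type (`SameCut.exists_partialIso`). A point outside `Z` is added after its
projection and generates nothing further.

In a model of `T₁`, `f` is a genuine rotation commuting with `S`. The modification changes each
iterate of `f` only by a power of `P`, which disturbs neither circularity nor infinite distances
(`isDefective_modify`). The missed point `P c₃` is what makes the modified map non-surjective. -/

namespace PseudoOMin

open FirstOrder FirstOrder.Language

/-! ### Compactness: from equality of types to quantifier elimination. -/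

section QuantifierElimination

variable {L : FirstOrder.Language.{0, 0}} {T : L.Theory} {n : ℕ}

/-- If, among the tuples satisfying a quantifier-free formula `χ`, the truth value of `φ` is
determined by those of finitely many quantifier-free formulas, then `φ` is equivalent to a
quantifier-free formula on these tuples. -/
theorem exists_isQF_of_finset (φ : L.Formula (Fin n))
    (Φ : Finset {ψ : L.Formula (Fin n) // BoundedFormula.IsQF ψ}) :
    ∀ χ : L.Formula (Fin n), BoundedFormula.IsQF χ →
      (∀ (M N : Theory.ModelType.{0, 0, 0} T) (a : Fin n → M) (b : Fin n → N),
        χ.Realize a → χ.Realize b →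
        (∀ ψ ∈ Φ, ψ.1.Realize a ↔ ψ.1.Realize b) → φ.Realize a → φ.Realize b) →
      ∃ ψ : L.Formula (Fin n), BoundedFormula.IsQF ψ ∧
        ∀ (M : Theory.ModelType.{0, 0, 0} T) (a : Fin n → M),
          χ.Realize a → (φ.Realize a ↔ ψ.Realize a) := by
  classical
  induction Φ using Finset.induction_on with
  | empty =>
    intro χ _ h
    by_cases h' : ∃ (M : Theory.ModelType.{0, 0, 0} T) (a : Fin n → M), χ.Realize a ∧ φ.Realize a
    · obtain ⟨M, a, h1, h2⟩ := h'
      refine ⟨⊤, .top, fun N b hb => ?_⟩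
      simpa using h M N a b h1 hb (by simp) h2
    · refine ⟨⊥, BoundedFormula.isQF_bot, fun N b hb => ?_⟩
      simpa using fun h2 => h' ⟨N, b, hb, h2⟩
  -- Induction is on the formulas not yet decided: `χ` absorbs either `θ` or its negation, and the
  -- two resulting formulas are glued along `θ`.
  | insert θ Φ _ ih =>
    intro χ hχ h
    obtain ⟨ψ₁, hψ₁, h₁⟩ := ih (χ ⊓ θ.1) (hχ.inf θ.2) fun M N a b ha hb hab =>
      h M N a b (Formula.realize_inf.1 ha).1 (Formula.realize_inf.1 hb).1 fun ψ hψ => by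
        rcases Finset.mem_insert.1 hψ with rfl | hψ
        · exact iff_of_true (Formula.realize_inf.1 ha).2 (Formula.realize_inf.1 hb).2
        · exact hab ψ hψ
    obtain ⟨ψ₂, hψ₂, h₂⟩ := ih (χ ⊓ θ.1.not) (hχ.inf θ.2.not) fun M N a b ha hb hab =>
      h M N a b (Formula.realize_inf.1 ha).1 (Formula.realize_inf.1 hb).1 fun ψ hψ => by
        rcases Finset.mem_insert.1 hψ with rfl | hψ
        · exact iff_of_false (Formula.realize_inf.1 ha).2 (Formula.realize_inf.1 hb).2
        · exact hab ψ hψ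
    refine ⟨(θ.1 ⊓ ψ₁) ⊔ (θ.1.not ⊓ ψ₂),
      (θ.2.inf hψ₁).sup (θ.2.not.inf hψ₂), fun M a ha => ?_⟩
    have h₁ := h₁ M a
    have h₂ := h₂ M a
    simp only [Formula.realize_inf, Formula.realize_sup, Formula.realize_not] at h₁ h₂ ⊢
    tauto

/-- A theory such that tuples with the same quantifier-free type have the same type admits
quantifier elimination. -/
theorem admitsQE_of_realize
    (h : ∀ (n : ℕ) (φ : L.Formula (Fin n)) (M N : Theory.ModelType.{0, 0, 0} T)
      (a : Fin n → M) (b : Fin n → N),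
      (∀ ψ : L.Formula (Fin n), BoundedFormula.IsQF ψ → (ψ.Realize a ↔ ψ.Realize b)) →
      φ.Realize a → φ.Realize b) : AdmitsQE T := by
  classical
  intro n φ
  by_cases hΦ : ∃ Φ : Finset {ψ : L.Formula (Fin n) // BoundedFormula.IsQF ψ},
      ∀ (M N : Theory.ModelType.{0, 0, 0} T) (a : Fin n → M) (b : Fin n → N),
        (∀ ψ ∈ Φ, ψ.1.Realize a ↔ ψ.1.Realize b) → φ.Realize a → φ.Realize b
  · obtain ⟨Φ, hΦ⟩ := hΦ
    obtain ⟨ψ, hψ, h'⟩ := exists_isQF_of_finset (T := T) φ Φ ⊤ .top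
      fun M N a b _ _ hab => hΦ M N a b hab
    refine ⟨ψ, hψ, Theory.models_formula_iff.2 fun M v => ?_⟩
    exact Formula.realize_iff.2 (h' M v (Formula.realize_top.2 trivial))
  -- If no finite set of quantifier-free formulas decides `φ`, each finite set has a pair of tuples
  -- as counterexample. An ultrafilter finer than `atTop` makes the limit tuples agree on every
  -- quantifier-free formula, while they still disagree on `φ`.
  · push Not at hΦ
    choose M N a b hab ha hb using hΦ
    let U : Ultrafilter (Finset {ψ : L.Formula (Fin n) // BoundedFormula.IsQF ψ}) :=
      Ultrafilter.of Filter.atTop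
    have hM : (U : Filter _).Product (fun i => M i) ⊨ T :=
      Theory.model_iff _ |>.2 fun σ hσ => (Ultraproduct.sentence_realize σ).2
        (.of_forall fun i => Theory.realize_sentence_of_mem T hσ)
    have hN : (U : Filter _).Product (fun i => N i) ⊨ T :=
      Theory.model_iff _ |>.2 fun σ hσ => (Ultraproduct.sentence_realize σ).2
        (.of_forall fun i => Theory.realize_sentence_of_mem T hσ)
    have key := h n φ (.of T ((U : Filter _).Product fun i => M i))
      (.of T ((U : Filter _).Product fun i => N i))
      (fun j => Quotient.mk'' (fun i => a i j : ∀ i, M i))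
      (fun j => Quotient.mk'' (fun i => b i j : ∀ i, N i))
    have hA := fun ψ : L.Formula (Fin n) => Ultraproduct.realize_formula_cast (u := U) ψ
      (fun j i => a i j)
    have hB := fun ψ : L.Formula (Fin n) => Ultraproduct.realize_formula_cast (u := U) ψ
      (fun j i => b i j)
    have := key (fun ψ hψ => ?_) ((hA φ).2 (.of_forall ha))
    · obtain ⟨i, hi⟩ := ((hB φ).1 this).exists
      exact (hb i hi).elim
    · refine (hA ψ).trans (Iff.trans (Filter.eventually_congr ?_) (hB ψ).symm)
      have : ∀ᶠ i in (U : Filter (Finset {ψ : L.Formula (Fin n) // BoundedFormula.IsQF ψ})),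
          {⟨ψ, hψ⟩} ≤ i :=
        (Ultrafilter.of_le _) (Filter.eventually_ge_atTop _)
      filter_upwards [this] with i hi
      exact hab i ⟨ψ, hψ⟩ (hi (Finset.mem_singleton_self _))

end QuantifierElimination

/-! ### Limits of elements in ultrapowers. -/

section Extensions

variable {L : FirstOrder.Language.{0, 0}}

/-- A family of elements indexed by the finite sets of parameters, of which each first-order
condition over finitely many parameters is eventually decided, has a limit in an elementary
extension. -/
theorem exists_elementaryEmbedding_realize {N : Type u} [L.Structure N] [Nonempty N]
    (y : Finset N → N) :
    ∃ (N' : Type u) (_ : L.Structure N') (j : N ↪ₑ[L] N') (y' : N'),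
      -- One parameter at a time is enough, since cuts are described by comparisons with single
      -- elements.
      ∀ (φ : L.Formula (Fin 2)) (b : N),
        (∃ F₀ : Finset N, ∀ F, F₀ ⊆ F → φ.Realize ![b, y F]) → φ.Realize ![j b, y'] := by
  let U : Ultrafilter (Finset N) := Ultrafilter.of Filter.atTop
  refine ⟨(U : Filter _).Product fun _ => N, inferInstance,
    ⟨fun b => Quotient.mk'' (fun _ => b : ∀ _ : Finset N, N),
      fun n φ x => ?_⟩, Quotient.mk'' y, ?_⟩
  · exact (Ultraproduct.realize_formula_cast (u := U) φ (fun j _ => x j)).trans (by simp)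
  · rintro φ b ⟨F₀, h⟩
    have := (Ultraproduct.realize_formula_cast (u := U) φ
      (![fun _ => b, y] : Fin 2 → Finset N → N)).2 ?_
    · refine (congrArg φ.Realize (funext fun i => ?_)).mpr this
      fin_cases i <;> rfl
    · have : ∀ᶠ i in (U : Filter (Finset N)), F₀ ≤ i :=
        (Ultrafilter.of_le _) (Filter.eventually_ge_atTop _)
      filter_upwards [this] with i hi
      refine (congrArg φ.Realize (funext fun i => ?_)).mpr (h i hi)
      fin_cases i <;> rfl

end Extensions

/-! ### Discrete sets with a defective rotation -/

/-- The functions, constants and the set occurring in a defective rotation. -/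
structure RotationData (N : Type u) where
  Z : Set N
  S : N → N
  P : N → N
  π : N → N
  f : N → N
  g : N → N
  c₁ : N
  c₂ : N
  c₃ : N
  c₄ : N

/-- `Z` is a discrete set with endpoints `c₁` and `c₄`, cyclic successor `S` and projection
`π`. -/
structure RotationData.IsDiscrete {N : Type u} [LinearOrder N] (A : RotationData N) : Prop where
  c₁_mem : A.c₁ ∈ A.Z
  c₂_mem : A.c₂ ∈ A.Z
  c₃_mem : A.c₃ ∈ A.Z
  c₄_mem : A.c₄ ∈ A.Z
  c₁_le : ∀ z ∈ A.Z, A.c₁ ≤ z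
  le_c₄ : ∀ z ∈ A.Z, z ≤ A.c₄
  c₂_lt_c₃ : A.c₂ < A.c₃
  S_mem : ∀ z ∈ A.Z, A.S z ∈ A.Z
  P_S : ∀ x, A.P (A.S x) = x
  S_P : ∀ x, A.S (A.P x) = x
  S_c₄ : A.S A.c₄ = A.c₁
  lt_S : ∀ z ∈ A.Z, z ≠ A.c₄ → z < A.S z
  S_le : ∀ x ∈ A.Z, ∀ z ∈ A.Z, x < z → A.S x ≤ z
  S_of_notMem : ∀ x ∉ A.Z, A.S x = x
  π_mem : ∀ x, A.π x ∈ A.Z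
  π_of_mem : ∀ z ∈ A.Z, A.π z = z
  lt_π : ∀ x ∉ A.Z, x < A.c₄ → x < A.π x
  π_le : ∀ x ∉ A.Z, ∀ z ∈ A.Z, x < z → A.π x ≤ z
  π_of_c₄_lt : ∀ x, A.c₄ < x → A.π x = A.c₁

/-- The first-order properties of the structures `𝓜₂` on which the elimination of quantifiers
rests: `Z` is a discrete set, and `f` is a rotation of `Z` that misses the single point
`P c₃`. -/
structure RotationData.IsDefective {N : Type u} [LinearOrder N] (A : RotationData N) : Prop
    extends A.IsDiscrete where
  f_mem : ∀ z ∈ A.Z, A.f z ∈ A.Z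
  g_mem : ∀ z ∈ A.Z, A.g z ∈ A.Z
  f_of_notMem : ∀ x ∉ A.Z, A.f x = x
  g_of_notMem : ∀ x ∉ A.Z, A.g x = x
  g_f : ∀ x, A.g (A.f x) = x
  f_g : ∀ z, z ≠ A.P A.c₃ → A.f (A.g z) = z
  -- The point without preimage gets the least element of `Z` as value, so that `u < g (P c₃)` fails
  -- for every `u ∈ Z`.
  g_P_c₃ : A.g (A.P A.c₃) = A.c₁
  -- At `c₄` the identity fails: `f (S c₄) = f c₁` is at least `c₃`, while `S (f c₄)` is at most `P
  -- c₃`.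
  f_S : ∀ z ∈ A.Z, z ≠ A.c₄ → A.f (A.S z) = A.S (A.f z)
  c₃_le_f : ∀ z ∈ A.Z, z ≤ A.c₂ → A.c₃ ≤ A.f z
  f_lt : ∀ z ∈ A.Z, A.c₂ < z → A.f z < A.P A.c₃
  f_lt_f_of_le : ∀ x ∈ A.Z, ∀ z ∈ A.Z, z ≤ A.c₂ → x < z → A.f x < A.f z
  f_lt_f_of_lt : ∀ x ∈ A.Z, ∀ z ∈ A.Z, A.c₂ < x → x < z → A.f x < A.f z
  circular : ∀ n, ∀ z ∈ A.Z, (A.f^[n + 2] z < A.f z ∧ A.f z < z) ∨ (A.f z < z ∧ z < A.f^[n + 2] z) ∨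
    (z < A.f^[n + 2] z ∧ A.f^[n + 2] z < A.f z)
  -- Together with the next field: no positive iterate of `f` stays in the `S`-chain of its
  -- argument.
  iterate_f_ne_iterate_S : ∀ n k, ∀ z ∈ A.Z, A.f^[n + 1] z ≠ A.S^[k] z
  iterate_f_ne_iterate_P : ∀ n k, ∀ z ∈ A.Z, A.f^[n + 1] z ≠ A.P^[k] z

/-- A linear order with a defective rotation of a discrete set. -/
structure DefectiveRotation (N : Type u) [LinearOrder N] extends RotationData N,
  RotationData.IsDefective toRotationData

namespace DefectiveRotation

variable {M : Type u} [LinearOrder M] (A : DefectiveRotation M)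

theorem P_of_notMem {x : M} (hx : x ∉ A.Z) : A.P x = x := by
  conv_lhs => rw [← A.S_of_notMem x hx]
  exact A.P_S x

theorem P_mem {x : M} (hx : x ∈ A.Z) : A.P x ∈ A.Z := by
  by_contra h
  have := A.S_of_notMem _ h
  rw [A.S_P] at this
  exact h (this ▸ hx)

theorem le_of_lt_S {x z : M} (hx : x ∈ A.Z) (hz : z ∈ A.Z) (h : x < A.S z) : x ≤ z :=
  not_lt.1 fun h' => (A.S_le z hz x hx h').not_gt h

theorem P_ne_c₄ {z : M} (h : z ≠ A.c₁) : A.P z ≠ A.c₄ := fun h' => h <| by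
  rw [← A.S_P z, h', A.S_c₄]

theorem P_lt {z : M} (hz : z ∈ A.Z) (h : z ≠ A.c₁) : A.P z < z := by
  simpa [A.S_P] using A.lt_S (A.P z) (A.P_mem hz) (A.P_ne_c₄ h)

/-- This and its analogues for `P`, `f`, `g` move a function from `u` to the other side, so that `u`
itself is compared only with points of any substructure containing `a`. The clause `a ≠ c₁` is
needed because `P` wraps `c₁` around to `c₄`. -/
theorem S_lt_iff {u a : M} (hu : u ∈ A.Z) (ha : a ∈ A.Z) (h : u ≠ A.c₄) :
    A.S u < a ↔ a ≠ A.c₁ ∧ u < A.P a := by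
  constructor
  · intro h'
    have hne : a ≠ A.c₁ := fun e => (A.c₁_le _ (A.S_mem u hu)).not_gt (e ▸ h')
    refine ⟨hne, lt_of_le_of_ne (A.le_of_lt_S hu (A.P_mem ha) ?_) ?_⟩
    · rw [A.S_P]
      exact (A.lt_S u hu h).trans h'
    · rintro rfl
      exact h'.ne (A.S_P a)
  · rintro ⟨hne, h'⟩
    exact (A.S_le u hu _ (A.P_mem ha) h').trans_lt (A.P_lt ha hne)

theorem P_lt_iff {u a : M} (hu : u ∈ A.Z) (ha : a ∈ A.Z) (h : u ≠ A.c₁) :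
    A.P u < a ↔ a = A.c₄ ∨ u < A.S a := by
  by_cases hne : a = A.c₄
  · refine iff_of_true ?_ (.inl hne)
    rw [hne]
    exact lt_of_le_of_ne (A.le_c₄ _ (A.P_mem hu)) (A.P_ne_c₄ h)
  · simp only [hne, false_or]
    constructor
    · intro h'
      have := A.S_le _ (A.P_mem hu) a ha h'
      rw [A.S_P] at this
      exact this.trans_lt (A.lt_S a ha hne)
    · exact fun h' => (A.P_lt hu h).trans_le (A.le_of_lt_S hu ha h')

theorem P_c₃_lt : A.P A.c₃ < A.c₃ := A.P_lt A.c₃_mem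
  ((A.c₁_le _ A.c₂_mem).trans_lt A.c₂_lt_c₃).ne'

theorem f_lt_iff {u a : M} (hu : u ∈ A.Z) (ha : a ∈ A.Z) (h : u ≠ A.c₂) :
    A.f u < a ↔ (a < A.P A.c₃ ∧ ¬ u < A.c₂ ∧ u < A.g a) ∨
      (¬ a < A.P A.c₃ ∧ (¬ u < A.c₂ ∨ u < A.g a)) := by
  have h0 := A.P_c₃_lt
  have h1 := A.c₃_le_f u hu
  have h2 := A.f_lt u hu
  -- Here `g` does not invert `f`; the value `c₁` makes `u < g a` false, and both sides then say
  -- that `u` is above `c₂`.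
  by_cases hne : a = A.P A.c₃
  · subst hne
    rw [A.g_P_c₃]
    have := A.c₁_le u hu
    grind
  have h3 := A.f_g a hne
  have hg := A.g_mem a ha
  have h4 := A.c₃_le_f _ hg
  have h5 := A.f_lt _ hg
  have h6 := A.f_lt_f_of_le u hu _ hg
  have h7 := A.f_lt_f_of_lt u hu _ hg
  have h8 := A.f_lt_f_of_le _ hg u hu
  have h9 := A.f_lt_f_of_lt _ hg u hu
  rw [h3] at h4 h5 h6 h7 h8 h9
  have h10 : A.g a = u → a = A.f u := fun h => by rw [← h, h3]
  grind

/-- `f` exchanges the two pieces cut off at `c₂` and is increasing on each. -/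
theorem f_lt_f_iff {u w : M} (hu : u ∈ A.Z) (hw : w ∈ A.Z) :
    A.f u < A.f w ↔ (¬ A.c₂ < w ∧ A.c₂ < u) ∨
      ((A.c₂ < u ↔ A.c₂ < w) ∧ u < w) := by
  have h0 := A.P_c₃_lt
  have h1 := A.c₃_le_f u hu
  have h2 := A.f_lt u hu
  have h4 := A.c₃_le_f _ hw
  have h5 := A.f_lt _ hw
  have h6 := A.f_lt_f_of_le u hu _ hw
  have h7 := A.f_lt_f_of_lt u hu _ hw
  have h8 := A.f_lt_f_of_le _ hw u hu
  have h9 := A.f_lt_f_of_lt _ hw u hu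
  have h10 : w = u → A.f w = A.f u := fun h => by rw [h]
  grind

theorem g_lt_iff {u a : M} (hu : u ∈ A.Z) (ha : a ∈ A.Z) (h : u ≠ A.P A.c₃) :
    A.g u < a ↔ (A.c₂ < a ∧ (¬ u < A.c₃ ∨ u < A.f a)) ∨
      (¬ A.c₂ < a ∧ ¬ u < A.c₃ ∧ u < A.f a) := by
  have h1 := A.f_lt_f_iff (A.g_mem u hu) ha
  have h2 := A.c₃_le_f _ (A.g_mem u hu)
  have h3 := A.f_lt _ (A.g_mem u hu)
  have h0 := A.P_c₃_lt
  rw [A.f_g u h] at h1 h2 h3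
  grind

/-! ### The two commuting permutations of the generic points. -/

/-- A set containing the constants and closed under the functions other than `π`. -/
structure IsClosed (D : Set M) : Prop where
  c₁_mem : A.c₁ ∈ D
  c₂_mem : A.c₂ ∈ D
  c₃_mem : A.c₃ ∈ D
  c₄_mem : A.c₄ ∈ D
  S_mem : ∀ x ∈ D, A.S x ∈ D
  P_mem : ∀ x ∈ D, A.P x ∈ D
  f_mem : ∀ x ∈ D, A.f x ∈ D
  g_mem : ∀ x ∈ D, A.g x ∈ D

/-- The points of `Z` outside of `D`. -/
abbrev Generic (D : Set M) : Type u := {u : M // u ∈ A.Z ∧ u ∉ D}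

variable {A} {D : Set M} (hD : A.IsClosed D)

theorem IsClosed.ne {a : M} (ha : a ∈ D) (u : A.Generic D) : u.1 ≠ a :=
  fun h => u.2.2 (h ▸ ha)

/-- The successor function, as a permutation of the generic points. -/
def IsClosed.shift : Equiv.Perm (A.Generic D) where
  toFun u := ⟨A.S u.1, A.S_mem _ u.2.1, fun h => u.2.2 (A.P_S u.1 ▸ hD.P_mem _ h)⟩
  invFun u := ⟨A.P u.1, A.P_mem u.2.1, fun h => u.2.2 (A.S_P u.1 ▸ hD.S_mem _ h)⟩
  left_inv _ := Subtype.ext (A.P_S _)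
  right_inv _ := Subtype.ext (A.S_P _)

/-- The map `f`, as a permutation of the generic points. -/
def IsClosed.rot : Equiv.Perm (A.Generic D) where
  toFun u := ⟨A.f u.1, A.f_mem _ u.2.1, fun h => u.2.2 (A.g_f u.1 ▸ hD.g_mem _ h)⟩
  invFun u := ⟨A.g u.1, A.g_mem _ u.2.1, fun h => u.2.2
    (A.f_g u.1 (IsClosed.ne (hD.P_mem _ hD.c₃_mem) u) ▸ hD.f_mem _ h)⟩
  left_inv _ := Subtype.ext (A.g_f _)
  right_inv u := Subtype.ext (A.f_g _ (IsClosed.ne (hD.P_mem _ hD.c₃_mem) u))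

@[simp] theorem IsClosed.shift_val (u : A.Generic D) : (hD.shift u).1 = A.S u.1 := rfl
@[simp] theorem IsClosed.shift_inv_val (u : A.Generic D) : (hD.shift⁻¹ u).1 = A.P u.1 := rfl
@[simp] theorem IsClosed.rot_val (u : A.Generic D) : (hD.rot u).1 = A.f u.1 := rfl
@[simp] theorem IsClosed.rot_inv_val (u : A.Generic D) : (hD.rot⁻¹ u).1 = A.g u.1 := rfl

theorem IsClosed.commute : Commute hD.rot hD.shift :=
  Equiv.ext fun u => Subtype.ext (A.f_S u.1 u.2.1 (IsClosed.ne hD.c₄_mem u))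

theorem IsClosed.shift_pow_val (k : ℕ) (u : A.Generic D) :
    ((hD.shift ^ k) u).1 = A.S^[k] u.1 := by
  induction k with
  | zero => rfl
  | succ k ih => rw [pow_succ', Function.iterate_succ_apply', ← ih]; rfl

theorem IsClosed.shift_inv_pow_val (k : ℕ) (u : A.Generic D) :
    ((hD.shift⁻¹ ^ k) u).1 = A.P^[k] u.1 := by
  induction k with
  | zero => rfl
  | succ k ih => rw [pow_succ', Function.iterate_succ_apply', ← ih]; rfl

theorem IsClosed.rot_pow_val (k : ℕ) (u : A.Generic D) :
    ((hD.rot ^ k) u).1 = A.f^[k] u.1 := by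
  induction k with
  | zero => rfl
  | succ k ih => rw [pow_succ', Function.iterate_succ_apply', ← ih]; rfl

theorem IsClosed.rot_pow_ne (n : ℕ) (k : ℤ) (u : A.Generic D) :
    (hD.rot ^ (n + 1)) u ≠ (hD.shift ^ k) u := fun h => by
  have h := congrArg Subtype.val h
  rw [hD.rot_pow_val] at h
  obtain ⟨k, rfl | rfl⟩ := k.eq_nat_or_neg
  · rw [zpow_natCast, hD.shift_pow_val] at h
    exact A.iterate_f_ne_iterate_S n k u.1 u.2.1 h
  · rw [zpow_neg, zpow_natCast, ← inv_pow, hD.shift_inv_pow_val] at h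
    exact A.iterate_f_ne_iterate_P n k u.1 u.2.1 h

theorem IsClosed.shift_lt_shift_iff (k j : ℤ) (u : A.Generic D) :
    ((hD.shift ^ k) u).1 < ((hD.shift ^ j) u).1 ↔ k < j := by
  refine StrictMono.lt_iff_lt (f := fun k : ℤ => ((hD.shift ^ k) u).1)
    (strictMono_int_of_lt_succ fun k => ?_)
  rw [add_comm, zpow_one_add, Equiv.Perm.mul_apply, hD.shift_val]
  exact A.lt_S _ ((hD.shift ^ k) u).2.1 (IsClosed.ne hD.c₄_mem _)

/-- No point of `Z` lies strictly between `w` and `S w`, so a point outside the `S`-chain of `w` is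
on the same side of the whole chain. -/
theorem IsClosed.lt_shift_iff {u w : A.Generic D} (h : ∀ k : ℤ, u ≠ (hD.shift ^ k) w) (k : ℤ) :
    u.1 < ((hD.shift ^ k) w).1 ↔ u.1 < w.1 := by
  have key : ∀ w : A.Generic D, u ≠ w → (u.1 < (hD.shift w).1 ↔ u.1 < w.1) := fun w h =>
    ⟨fun h' => lt_of_le_of_ne (A.le_of_lt_S u.2.1 w.2.1 h') fun e => h (Subtype.ext e),
      fun h' => h'.trans (A.lt_S _ w.2.1 (IsClosed.ne hD.c₄_mem _))⟩
  induction k using Int.induction_on with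
  | zero => rfl
  | succ k ih =>
    refine Iff.trans ?_ ih
    rw [← key _ (h k), add_comm, zpow_one_add, Equiv.Perm.mul_apply]
  | pred k ih =>
    refine Iff.trans ?_ ih
    rw [← key _ (h _), ← Equiv.Perm.mul_apply, ← zpow_one_add, add_sub_cancel]

theorem IsClosed.shift_lt_shift_iff' {u w : A.Generic D} (h : ∀ k : ℤ, u ≠ (hD.shift ^ k) w)
    (k j : ℤ) : ((hD.shift ^ k) u).1 < ((hD.shift ^ j) w).1 ↔ u.1 < w.1 := by
  have h1 : ∀ i : ℤ, (hD.shift ^ k) u ≠ (hD.shift ^ i) w := fun i e => h (i - k) <| by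
    rw [sub_eq_neg_add, zpow_add, Equiv.Perm.mul_apply, ← e, ← Equiv.Perm.mul_apply, ← zpow_add]
    simp
  have h2 : ∀ i : ℤ, w ≠ (hD.shift ^ i) u := fun i e => h (-i) <| by
    rw [e, ← Equiv.Perm.mul_apply, ← zpow_add]
    simp
  have h3 : w.1 ≠ u.1 := fun e => h2 0 (Subtype.ext e)
  have h4 : w.1 ≠ ((hD.shift ^ k) u).1 := fun e => h2 k (Subtype.ext e)
  rw [hD.lt_shift_iff h1]
  have := hD.lt_shift_iff h2 k
  grind

end DefectiveRotation

/-! ### Partial isomorphisms and corresponding cuts. -/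

namespace DefectiveRotation

variable {M : Type u} [LinearOrder M] {N : Type v} [LinearOrder N]
  {A : DefectiveRotation M} {B : DefectiveRotation N} {R : M → N → Prop}

/-- A correspondence between substructures that preserves and reflects the relations. -/
structure PartialIso (A : DefectiveRotation M) (B : DefectiveRotation N) (R : M → N → Prop) :
    Prop where
  lt_iff : ∀ {a b a' b'}, R a b → R a' b' → (a < a' ↔ b < b')
  mem_iff : ∀ {a b}, R a b → (a ∈ A.Z ↔ b ∈ B.Z)
  c₁ : R A.c₁ B.c₁
  c₂ : R A.c₂ B.c₂
  c₃ : R A.c₃ B.c₃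
  c₄ : R A.c₄ B.c₄
  S : ∀ {a b}, R a b → R (A.S a) (B.S b)
  P : ∀ {a b}, R a b → R (A.P a) (B.P b)
  π : ∀ {a b}, R a b → R (A.π a) (B.π b)
  f : ∀ {a b}, R a b → R (A.f a) (B.f b)
  g : ∀ {a b}, R a b → R (A.g a) (B.g b)

namespace PartialIso

theorem eq_iff (h : PartialIso A B R) {a b a' b'} (hab : R a b) (hab' : R a' b') :
    a = a' ↔ b = b' := by
  have := h.lt_iff hab hab'
  have := h.lt_iff hab' hab
  grind

theorem symm (h : PartialIso A B R) : PartialIso B A (fun b a => R a b) where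
  lt_iff h₁ h₂ := (h.lt_iff h₁ h₂).symm
  mem_iff h₁ := (h.mem_iff h₁).symm
  c₁ := h.c₁
  c₂ := h.c₂
  c₃ := h.c₃
  c₄ := h.c₄
  S := h.S
  P := h.P
  π := h.π
  f := h.f
  g := h.g

theorem dom (h : PartialIso A B R) : A.IsClosed {a | ∃ b, R a b} where
  c₁_mem := ⟨_, h.c₁⟩
  c₂_mem := ⟨_, h.c₂⟩
  c₃_mem := ⟨_, h.c₃⟩
  c₄_mem := ⟨_, h.c₄⟩
  S_mem := fun _ ⟨_, hb⟩ => ⟨_, h.S hb⟩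
  P_mem := fun _ ⟨_, hb⟩ => ⟨_, h.P hb⟩
  f_mem := fun _ ⟨_, hb⟩ => ⟨_, h.f hb⟩
  g_mem := fun _ ⟨_, hb⟩ => ⟨_, h.g hb⟩

theorem ran (h : PartialIso A B R) : B.IsClosed {b | ∃ a, R a b} := h.symm.dom

end PartialIso

/-- Two generic points realize corresponding cuts. -/
def SameCut (R : M → N → Prop) (u : A.Generic {a | ∃ b, R a b})
    (v : B.Generic {b | ∃ a, R a b}) : Prop :=
  ∀ a b, R a b → a ∈ A.Z → (u.1 < a ↔ v.1 < b)

namespace SameCut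

variable {u : A.Generic {a | ∃ b, R a b}} {v : B.Generic {b | ∃ a, R a b}}

theorem shift (h : SameCut R u v) (hR : PartialIso A B R) :
    SameCut R (hR.dom.shift u) (hR.ran.shift v) := fun a b hab ha => by
  have hb := (hR.mem_iff hab).1 ha
  rw [hR.dom.shift_val, hR.ran.shift_val, A.S_lt_iff u.2.1 ha (IsClosed.ne hR.dom.c₄_mem u),
    B.S_lt_iff v.2.1 hb (IsClosed.ne hR.ran.c₄_mem v), h _ _ (hR.P hab) (A.P_mem ha),
    Ne, Ne, hR.eq_iff hab hR.c₁]

theorem shift_inv (h : SameCut R u v) (hR : PartialIso A B R) :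
    SameCut R (hR.dom.shift⁻¹ u) (hR.ran.shift⁻¹ v) := fun a b hab ha => by
  have hb := (hR.mem_iff hab).1 ha
  rw [hR.dom.shift_inv_val, hR.ran.shift_inv_val,
    A.P_lt_iff u.2.1 ha (IsClosed.ne hR.dom.c₁_mem u),
    B.P_lt_iff v.2.1 hb (IsClosed.ne hR.ran.c₁_mem v), h _ _ (hR.S hab) (A.S_mem _ ha),
    hR.eq_iff hab hR.c₄]

theorem rot (h : SameCut R u v) (hR : PartialIso A B R) :
    SameCut R (hR.dom.rot u) (hR.ran.rot v) := fun a b hab ha => by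
  have hb := (hR.mem_iff hab).1 ha
  rw [hR.dom.rot_val, hR.ran.rot_val, A.f_lt_iff u.2.1 ha (IsClosed.ne hR.dom.c₂_mem u),
    B.f_lt_iff v.2.1 hb (IsClosed.ne hR.ran.c₂_mem v), h _ _ (hR.g hab) (A.g_mem _ ha),
    h _ _ hR.c₂ A.c₂_mem, hR.lt_iff hab (hR.P hR.c₃)]

theorem rot_inv (h : SameCut R u v) (hR : PartialIso A B R) :
    SameCut R (hR.dom.rot⁻¹ u) (hR.ran.rot⁻¹ v) := fun a b hab ha => by
  have hb := (hR.mem_iff hab).1 ha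
  rw [hR.dom.rot_inv_val, hR.ran.rot_inv_val,
    A.g_lt_iff u.2.1 ha (IsClosed.ne (hR.dom.P_mem _ hR.dom.c₃_mem) u),
    B.g_lt_iff v.2.1 hb (IsClosed.ne (hR.ran.P_mem _ hR.ran.c₃_mem) v),
    h _ _ (hR.f hab) (A.f_mem _ ha), h _ _ hR.c₃ A.c₃_mem, hR.lt_iff hR.c₂ hab]

theorem shift_zpow (h : SameCut R u v) (hR : PartialIso A B R) (k : ℤ) :
    SameCut R ((hR.dom.shift ^ k) u) ((hR.ran.shift ^ k) v) := by
  induction k using Int.induction_on with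
  | zero => exact h
  | succ k ih =>
    rw [add_comm, zpow_one_add, zpow_one_add]
    exact ih.shift hR
  | pred k ih =>
    rw [sub_eq_neg_add, zpow_add, zpow_add _ (-1), zpow_neg_one, zpow_neg_one]
    exact ih.shift_inv hR

theorem rot_zpow (h : SameCut R u v) (hR : PartialIso A B R) (k : ℤ) :
    SameCut R ((hR.dom.rot ^ k) u) ((hR.ran.rot ^ k) v) := by
  induction k using Int.induction_on with
  | zero => exact h
  | succ k ih =>
    rw [add_comm, zpow_one_add, zpow_one_add]
    exact ih.rot hR
  | pred k ih =>
    rw [sub_eq_neg_add, zpow_add, zpow_add _ (-1), zpow_neg_one, zpow_neg_one]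
    exact ih.rot_inv hR

/-- For `a ∉ Z` below `c₄`, no point of `Z` separates `a` from `π a`, so `π a` can replace `a`.
Above `c₄` the comparison is trivially true. -/
theorem lt_iff (h : SameCut R u v) (hR : PartialIso A B R) {a : M} {b : N} (hab : R a b) :
    u.1 < a ↔ v.1 < b := by
  by_cases ha : a ∈ A.Z
  · exact h a b hab ha
  have hb : b ∉ B.Z := fun hb => ha ((hR.mem_iff hab).2 hb)
  have h1 := h _ _ (hR.π hab) (A.π_mem a)
  have h2 := hR.lt_iff hab hR.c₄
  have h3 : a ≠ A.c₄ := fun e => ha (e ▸ A.c₄_mem)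
  have h4 : b ≠ B.c₄ := fun e => hb (e ▸ B.c₄_mem)
  have h5 := A.le_c₄ _ u.2.1
  have h6 := B.le_c₄ _ v.2.1
  have h7 := A.lt_π a ha
  have h8 := B.lt_π b hb
  have h9 := A.π_le a ha u.1 u.2.1
  have h10 := B.π_le b hb v.1 v.2.1
  have h11 : u.1 ≠ a := fun e => ha (e ▸ u.2.1)
  have h12 : v.1 ≠ b := fun e => hb (e ▸ v.2.1)
  grind

theorem lt_iff' (h : SameCut R u v) (hR : PartialIso A B R) {a : M} {b : N} (hab : R a b) :
    a < u.1 ↔ b < v.1 := by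
  have h1 := h.lt_iff hR hab
  have h2 : u.1 ≠ a := fun e => u.2.2 ⟨b, e ▸ hab⟩
  have h3 : v.1 ≠ b := fun e => v.2.2 ⟨a, e ▸ hab⟩
  grind

end SameCut

/-- Whether a generic point lies below its image under an iterate of `f`, in terms of smaller
iterates. -/
theorem IsClosed.lt_rot_pow_iff {D : Set M} (hD : A.IsClosed D) (u : A.Generic D) (n : ℕ) :
    u.1 < ((hD.rot ^ (n + 1)) u).1 ↔ u.1 < A.c₂ ∨
      (n ≠ 0 ∧ (((hD.rot ^ n) u).1 < A.c₂ ∨ u.1 < ((hD.rot ^ n) u).1)) := by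
  have hu := u.2.1
  have h0 := A.P_c₃_lt
  have h00 := A.c₂_lt_c₃
  have h1 := A.c₃_le_f u.1 hu
  have h2 := A.f_lt u.1 hu
  have h3 := IsClosed.ne hD.c₂_mem u
  have hcirc : ∀ n, _ := fun n => A.circular n u.1 hu
  -- If `u < c₂`, then `u < f u`, and circularity puts all further iterates between them. If `c₂ <
  -- u`, then `f u > u` would give `f (f u) > f u > u`, against circularity; so `f u < u`, and a
  -- further iterate is above `u` exactly when it is above `f u`. `f_lt_f_iff` then reduces this to
  -- the previous iterate.
  have h5 := A.f_lt_f_iff hu (A.f_mem _ hu)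
  have h7 := hcirc 0
  have hfix : A.f u.1 ≠ u.1 := by simpa using A.iterate_f_ne_iterate_S 0 0 u.1 hu
  have h8 : A.f^[0 + 2] u.1 = A.f (A.f u.1) := rfl
  rw [h8] at h7
  rcases n with _ | n
  · simp only [zero_add, pow_one, hD.rot_val, ne_eq, not_true_eq_false, false_and, or_false]
    grind
  · have h9 := hcirc n
    have h10 : A.f^[n + 2] u.1 = A.f (A.f^[n + 1] u.1) := Function.iterate_succ_apply' _ _ _
    have h11 := ((hD.rot ^ (n + 1)) u).2.1
    have h12 := IsClosed.ne hD.c₂_mem ((hD.rot ^ (n + 1)) u)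
    rw [hD.rot_pow_val] at h11 h12
    have h13 := A.f_lt_f_iff hu h11
    rw [hD.rot_pow_val, hD.rot_pow_val]
    grind

end DefectiveRotation

/-! ### Adjoining the orbit of a generic point, or a point outside `Z`; finite satisfiability of
cuts. -/

namespace DefectiveRotation

variable {M : Type u} [LinearOrder M] {N : Type v} [LinearOrder N]
  {A : DefectiveRotation M} {B : DefectiveRotation N} {R : M → N → Prop}

theorem IsClosed.f_orbit {D : Set M} (hD : A.IsClosed D) (k n : ℤ) (u : A.Generic D) :
    A.f ((hD.shift ^ k) ((hD.rot ^ n) u)).1 = ((hD.shift ^ k) ((hD.rot ^ (1 + n)) u)).1 := by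
  change ((hD.rot * hD.shift ^ k) ((hD.rot ^ n) u)).1 = _
  rw [(hD.commute.zpow_right k).eq, zpow_one_add]
  rfl

theorem IsClosed.g_orbit {D : Set M} (hD : A.IsClosed D) (k n : ℤ) (u : A.Generic D) :
    A.g ((hD.shift ^ k) ((hD.rot ^ n) u)).1 = ((hD.shift ^ k) ((hD.rot ^ (-1 + n)) u)).1 := by
  change ((hD.rot⁻¹ * hD.shift ^ k) ((hD.rot ^ n) u)).1 = _
  rw [(hD.commute.zpow_right k).inv_left.eq, zpow_add, zpow_neg_one]
  rfl

namespace SameCut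

variable {u : A.Generic {a | ∃ b, R a b}} {v : B.Generic {b | ∃ a, R a b}}

theorem lt_rot_pow_iff (h : SameCut R u v) (hR : PartialIso A B R) (n : ℕ) :
    u.1 < ((hR.dom.rot ^ (n + 1)) u).1 ↔ v.1 < ((hR.ran.rot ^ (n + 1)) v).1 := by
  have h2 := h.lt_iff hR hR.c₂
  induction n with
  | zero => rw [hR.dom.lt_rot_pow_iff, hR.ran.lt_rot_pow_iff, h2]; simp
  | succ n ih =>
    have h3 := (h.rot_zpow hR (n + 1 : ℕ)).lt_iff hR hR.c₂
    rw [zpow_natCast, zpow_natCast] at h3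
    rw [hR.dom.lt_rot_pow_iff, hR.ran.lt_rot_pow_iff, h2, h3]
    exact or_congr_right (and_congr_right' (or_congr_right ih))

/-- For `n = 0` both points lie on one `S`-chain and the exponents decide. Otherwise the chains are
different and the exponents are irrelevant. -/
theorem shift_lt_rot_iff (h : SameCut R u v) (hR : PartialIso A B R) (n : ℕ) (k j : ℤ) :
    (((hR.dom.shift ^ k) u).1 < ((hR.dom.shift ^ j) ((hR.dom.rot ^ n) u)).1 ↔
      ((hR.ran.shift ^ k) v).1 < ((hR.ran.shift ^ j) ((hR.ran.rot ^ n) v)).1) ∧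
    (((hR.dom.shift ^ j) ((hR.dom.rot ^ n) u)).1 < ((hR.dom.shift ^ k) u).1 ↔
      ((hR.ran.shift ^ j) ((hR.ran.rot ^ n) v)).1 < ((hR.ran.shift ^ k) v).1) := by
  rcases n with _ | n
  · simp only [pow_zero, Equiv.Perm.one_apply, IsClosed.shift_lt_shift_iff, and_self]
  · have h1 := hR.dom.rot_pow_ne n (u := u)
    have h2 := hR.ran.rot_pow_ne n (u := v)
    have h1' : ∀ k : ℤ, u ≠ (hR.dom.shift ^ k) ((hR.dom.rot ^ (n + 1)) u) :=
      fun k e => h1 (-k) <| by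
      rw [zpow_neg, Equiv.Perm.eq_inv_iff_eq, ← e]
    have h2' : ∀ k : ℤ, v ≠ (hR.ran.shift ^ k) ((hR.ran.rot ^ (n + 1)) v) :=
      fun k e => h2 (-k) <| by
      rw [zpow_neg, Equiv.Perm.eq_inv_iff_eq, ← e]
    rw [hR.dom.shift_lt_shift_iff' h1, hR.dom.shift_lt_shift_iff' h1',
      hR.ran.shift_lt_shift_iff' h2, hR.ran.shift_lt_shift_iff' h2']
    have h3 := h.lt_rot_pow_iff hR n
    have h4 : u.1 ≠ ((hR.dom.rot ^ (n + 1)) u).1 := fun e => h1 0 (Subtype.ext e.symm)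
    have h5 : v.1 ≠ ((hR.ran.rot ^ (n + 1)) v).1 := fun e => h2 0 (Subtype.ext e.symm)
    grind

/-- The smaller power of the rotation is absorbed into the base points, which still realize
corresponding cuts. -/
theorem orbit_lt_iff (h : SameCut R u v) (hR : PartialIso A B R) (k n j m : ℤ) :
    ((hR.dom.shift ^ k) ((hR.dom.rot ^ n) u)).1 < ((hR.dom.shift ^ j) ((hR.dom.rot ^ m) u)).1 ↔
      ((hR.ran.shift ^ k) ((hR.ran.rot ^ n) v)).1 <
        ((hR.ran.shift ^ j) ((hR.ran.rot ^ m) v)).1 := by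
  rcases le_total n m with hnm | hnm
  · obtain ⟨d, rfl⟩ := Int.le.dest hnm
    rw [add_comm n d, zpow_add, zpow_add, Equiv.Perm.mul_apply, Equiv.Perm.mul_apply,
      zpow_natCast, zpow_natCast]
    exact ((h.rot_zpow hR n).shift_lt_rot_iff hR d k j).1
  · obtain ⟨d, rfl⟩ := Int.le.dest hnm
    rw [add_comm m d, zpow_add, zpow_add, Equiv.Perm.mul_apply, Equiv.Perm.mul_apply,
      zpow_natCast, zpow_natCast]
    exact ((h.rot_zpow hR m).shift_lt_rot_iff hR d j k).2

theorem orbit (h : SameCut R u v) (hR : PartialIso A B R) (k n : ℤ) :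
    SameCut R ((hR.dom.shift ^ k) ((hR.dom.rot ^ n) u))
      ((hR.ran.shift ^ k) ((hR.ran.rot ^ n) v)) :=
  (h.rot_zpow hR n).shift_zpow hR k

/-- A partial isomorphism extends to generic points that realize corresponding cuts. -/
theorem exists_partialIso (h : SameCut R u v) (hR : PartialIso A B R) :
    ∃ R', PartialIso A B R' ∧ (∀ a b, R a b → R' a b) ∧ R' u.1 v.1 := by
  refine ⟨fun a b => R a b ∨ ∃ k n : ℤ, a = ((hR.dom.shift ^ k) ((hR.dom.rot ^ n) u)).1 ∧
    b = ((hR.ran.shift ^ k) ((hR.ran.rot ^ n) v)).1, ?_, fun a b hab => .inl hab,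
    .inr ⟨0, 0, rfl, rfl⟩⟩
  constructor
  case lt_iff =>
    rintro a b a' b' (hab | ⟨k, n, rfl, rfl⟩) (hab' | ⟨j, m, rfl, rfl⟩)
    · exact hR.lt_iff hab hab'
    · exact (h.orbit hR j m).lt_iff' hR hab
    · exact (h.orbit hR k n).lt_iff hR hab'
    · exact h.orbit_lt_iff hR k n j m
  case mem_iff =>
    rintro a b (hab | ⟨k, n, rfl, rfl⟩)
    · exact hR.mem_iff hab
    · exact iff_of_true ((hR.dom.shift ^ k) ((hR.dom.rot ^ n) u)).2.1
        ((hR.ran.shift ^ k) ((hR.ran.rot ^ n) v)).2.1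
  case c₁ => exact .inl hR.c₁
  case c₂ => exact .inl hR.c₂
  case c₃ => exact .inl hR.c₃
  case c₄ => exact .inl hR.c₄
  case S =>
    rintro a b (hab | ⟨k, n, rfl, rfl⟩)
    · exact .inl (hR.S hab)
    · refine .inr ⟨1 + k, n, ?_, ?_⟩ <;> rw [zpow_one_add] <;> rfl
  case P =>
    rintro a b (hab | ⟨k, n, rfl, rfl⟩)
    · exact .inl (hR.P hab)
    · refine .inr ⟨-1 + k, n, ?_, ?_⟩ <;> rw [zpow_add, zpow_neg_one] <;> rfl
  case π =>
    rintro a b (hab | ⟨k, n, rfl, rfl⟩)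
    · exact .inl (hR.π hab)
    · exact .inr ⟨k, n, A.π_of_mem _ ((hR.dom.shift ^ k) ((hR.dom.rot ^ n) u)).2.1,
        B.π_of_mem _ ((hR.ran.shift ^ k) ((hR.ran.rot ^ n) v)).2.1⟩
  case f =>
    rintro a b (hab | ⟨k, n, rfl, rfl⟩)
    · exact .inl (hR.f hab)
    · exact .inr ⟨k, 1 + n, hR.dom.f_orbit k n u, hR.ran.f_orbit k n v⟩
  case g =>
    rintro a b (hab | ⟨k, n, rfl, rfl⟩)
    · exact .inl (hR.g hab)
    · exact .inr ⟨k, -1 + n, hR.dom.g_orbit k n u, hR.ran.g_orbit k n v⟩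

end SameCut

/-- A partial isomorphism extends to points outside of `Z` that realize corresponding cuts. -/
theorem PartialIso.exists_partialIso_of_notMem (hR : PartialIso A B R) {x p : M} {y q : N}
    (hx : x ∉ A.Z) (hp : A.π x = p) (hpq : R p q) (hy : ∀ a, ¬ R a y)
    (h : ∀ a b, R a b → (x < a ↔ y < b)) (h' : ∀ a b, R a b → (a < x ↔ b < y)) :
    ∃ R', PartialIso A B R' ∧ (∀ a b, R a b → R' a b) ∧ R' x y := by
  have hpZ : p ∈ A.Z := hp ▸ A.π_mem x
  have hqZ : q ∈ B.Z := (hR.mem_iff hpq).1 hpZ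
  have hc₁ := hR.eq_iff hpq hR.c₁
  -- Since `p` is the first point of `Z` above `x`, its predecessor lies below `x`. Corresponding
  -- cuts then trap `y` strictly between `P q` and `q`, which gives both `y ∉ Z` and `π y = q`.
  have hP : q ≠ B.c₁ → x < A.c₄ → B.P q < y := fun hq hlt => by
    refine (h' _ _ (hR.P hpq)).1 (not_le.1 fun hle => ?_)
    have hne : x ≠ A.P p := fun e => hx (e ▸ A.P_mem hpZ)
    have h1 := A.π_le x hx _ (A.P_mem hpZ) (lt_of_le_of_ne hle hne)
    rw [hp] at h1
    exact (A.P_lt hpZ (fun e => hq (hc₁.1 e))).not_ge h1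
  have hxc₄ : x ≠ A.c₄ := fun e => hx (e ▸ A.c₄_mem)
  have hlt : x < A.c₄ → y < q := fun hlt => by
    rw [← h _ _ hpq, ← hp]
    exact A.lt_π x hx hlt
  have hyZ : y ∉ B.Z := fun hyZ => by
    rcases lt_or_gt_of_ne hxc₄ with hlt' | hlt'
    · have hyq := hlt hlt'
      have hq : q ≠ B.c₁ := by
        rintro rfl
        exact (B.c₁_le y hyZ).not_gt hyq
      have := B.S_le _ (B.P_mem hqZ) y hyZ (hP hq hlt')
      rw [B.S_P] at this
      exact this.not_gt hyq
    · exact (B.le_c₄ y hyZ).not_gt ((h' _ _ hR.c₄).1 hlt')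
  have hπ : B.π y = q := by
    rcases lt_or_gt_of_ne hxc₄ with hlt' | hlt'
    · have hyq := hlt hlt'
      refine le_antisymm (B.π_le y hyZ q hqZ hyq) ?_
      by_cases hq : q = B.c₁
      · exact hq ▸ B.c₁_le _ (B.π_mem y)
      · have := B.S_le _ (B.P_mem hqZ) _ (B.π_mem y) ((hP hq hlt').trans
          (B.lt_π y hyZ ((h _ _ hR.c₄).1 hlt')))
        rwa [B.S_P] at this
    · rw [B.π_of_c₄_lt y ((h' _ _ hR.c₄).1 hlt'), ← hc₁.1]
      rw [← hp, A.π_of_c₄_lt x hlt']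
  refine ⟨fun a b => R a b ∨ (a = x ∧ b = y), ?_, fun a b hab => .inl hab, .inr ⟨rfl, rfl⟩⟩
  constructor
  case lt_iff =>
    rintro a b a' b' (hab | ⟨rfl, rfl⟩) (hab' | ⟨rfl, rfl⟩)
    · exact hR.lt_iff hab hab'
    · exact h' _ _ hab
    · exact h _ _ hab'
    · simp
  case mem_iff =>
    rintro a b (hab | ⟨rfl, rfl⟩)
    · exact hR.mem_iff hab
    · exact iff_of_false hx hyZ
  case c₁ => exact .inl hR.c₁
  case c₂ => exact .inl hR.c₂
  case c₃ => exact .inl hR.c₃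
  case c₄ => exact .inl hR.c₄
  case S =>
    rintro a b (hab | ⟨rfl, rfl⟩)
    · exact .inl (hR.S hab)
    · exact .inr ⟨A.S_of_notMem _ hx, B.S_of_notMem _ hyZ⟩
  case P =>
    rintro a b (hab | ⟨rfl, rfl⟩)
    · exact .inl (hR.P hab)
    · exact .inr ⟨A.P_of_notMem hx, B.P_of_notMem hyZ⟩
  case π =>
    rintro a b (hab | ⟨rfl, rfl⟩)
    · exact .inl (hR.π hab)
    · rw [hp, hπ]
      exact .inl hpq
  case f =>
    rintro a b (hab | ⟨rfl, rfl⟩)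
    · exact .inl (hR.f hab)
    · exact .inr ⟨A.f_of_notMem _ hx, B.f_of_notMem _ hyZ⟩
  case g =>
    rintro a b (hab | ⟨rfl, rfl⟩)
    · exact .inl (hR.g hab)
    · exact .inr ⟨A.g_of_notMem _ hx, B.g_of_notMem _ hyZ⟩

/-- Over finitely many parameters, the cut of a generic point is realized in `Z`. -/
theorem PartialIso.exists_mem_between (hR : PartialIso A B R) (x : A.Generic {a | ∃ b, R a b})
    (F : Finset N) : ∃ y ∈ B.Z, ∀ a b, R a b → a ∈ A.Z → b ∈ F →
      (x.1 < a → y < b) ∧ (a < x.1 → b < y) := by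
  classical
  obtain ⟨x, hxZ, hxD⟩ := x
  have hc₁ : A.c₁ < x := lt_of_le_of_ne (A.c₁_le x hxZ) fun e => hxD ⟨_, e ▸ hR.c₁⟩
  -- The witness is the successor of the largest parameter below the cut; `c₁` is inserted to have
  -- at least one. This successor stays below each upper parameter because its partner `S a₀` is at
  -- most `x`.
  let F' := {b ∈ insert B.c₁ F | ∃ a, R a b ∧ a ∈ A.Z ∧ a < x}
  have hF' : F'.Nonempty :=
    ⟨B.c₁, Finset.mem_filter.2 ⟨Finset.mem_insert_self _ _, _, hR.c₁, A.c₁_mem, hc₁⟩⟩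
  have hmax := F'.le_max'
  obtain ⟨-, a₀, hab₀, ha₀, hax₀⟩ := Finset.mem_filter.1 (F'.max'_mem hF')
  generalize hb₀ : F'.max' hF' = b₀ at hab₀ hmax
  have hbZ₀ := (hR.mem_iff hab₀).1 ha₀
  have hne : b₀ ≠ B.c₄ := fun e => by
    rw [(hR.eq_iff hab₀ hR.c₄).2 e] at hax₀
    exact (A.le_c₄ x hxZ).not_gt hax₀
  refine ⟨B.S b₀, B.S_mem _ hbZ₀, fun a b hab ha hb => ⟨fun hlt => ?_, fun hlt => ?_⟩⟩
  · refine lt_of_le_of_ne (B.S_le _ hbZ₀ _ ((hR.mem_iff hab).1 ha)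
      ((hR.lt_iff hab₀ hab).1 (hax₀.trans hlt))) fun e => ?_
    rw [← hR.eq_iff (hR.S hab₀) hab] at e
    exact (A.S_le _ ha₀ x hxZ hax₀).not_gt (e ▸ hlt)
  · refine lt_of_le_of_lt (hb₀ ▸ hmax b ?_) (B.lt_S _ hbZ₀ hne)
    exact Finset.mem_filter.2 ⟨Finset.mem_insert_of_mem hb, a, hab, ha, hlt⟩

/-- Over finitely many parameters, the cut of any point is realized. -/
theorem PartialIso.exists_between [DenselyOrdered N] [NoMinOrder N] [NoMaxOrder N]
    (hR : PartialIso A B R) (x : M) (F : Finset N) : ∃ y, ∀ a b, R a b → b ∈ F →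
      (x < a → y < b) ∧ (a < x → b < y) := by
  classical
  have : Nonempty N := ⟨B.c₁⟩
  obtain ⟨y, hy, hy'⟩ := Order.exists_between_finsets {b ∈ F | ∃ a, R a b ∧ a < x}
    {b ∈ F | ∃ a, R a b ∧ x < a} fun b hb b' hb' => by
      obtain ⟨-, a, hab, ha⟩ := Finset.mem_filter.1 hb
      obtain ⟨-, a', hab', ha'⟩ := Finset.mem_filter.1 hb'
      exact (hR.lt_iff hab hab').1 (ha.trans ha')
  exact ⟨y, fun a b hab hb => ⟨fun h => hy' b (Finset.mem_filter.2 ⟨hb, a, hab, h⟩),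
    fun h => hy b (Finset.mem_filter.2 ⟨hb, a, hab, h⟩)⟩⟩

end DefectiveRotation

/-! ### Orders, terms and formulas in `L₁`-structures. -/

/-- The linear order given by the interpretation of `<`. -/
noncomputable abbrev IsDLO.linearOrder {M : Type u} {𝓜 : L₀.Structure M} (h : IsDLO 𝓜) :
    LinearOrder M where
  lt := lt 𝓜
  le := le 𝓜
  le_refl _ := .inr rfl
  le_trans x y z := by
    rintro (hxy | rfl) (hyz | rfl)
    · exact .inl (h.trans _ _ _ hxy hyz)
    · exact .inl hxy
    · exact .inl hyz
    · exact .inr rfl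
  le_antisymm x y := by
    rintro (hxy | rfl) (hyx | h')
    · exact (h.irrefl _ (h.trans _ _ _ hxy hyx)).elim
    · exact h'.symm
    · rfl
    · rfl
  lt_iff_le_not_ge x y := by
    constructor
    · refine fun hxy => ⟨.inl hxy, ?_⟩
      rintro (hyx | rfl)
      · exact h.irrefl _ (h.trans _ _ _ hxy hyx)
      · exact h.irrefl _ hxy
    · rintro ⟨hxy | rfl, hyx⟩
      · exact hxy
      · exact (hyx (.inr rfl)).elim
  le_total x y := by
    rcases h.total x y with hxy | rfl | hxy
    · exact .inl (.inl hxy)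
    · exact .inl (.inr rfl)
    · exact .inr (.inl hxy)
  toDecidableLE := Classical.decRel _

/-- The interpretations of the symbols of `L₁`. -/
def rotationData {M : Type u} (𝓜 : L₁.Structure M) : RotationData M where
  Z := Z (reduct₀ 𝓜)
  S := S (reduct₀ 𝓜)
  P := P (reduct₀ 𝓜)
  π := π (reduct₀ 𝓜)
  f := f 𝓜
  g := g 𝓜
  c₁ := c₁ (reduct₀ 𝓜)
  c₂ := c₂ (reduct₀ 𝓜)
  c₃ := c₃ (reduct₀ 𝓜)
  c₄ := c₄ (reduct₀ 𝓜)

section Terms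

variable {α : Type*}

abbrev c₁Term : L₁.Term α := Constants.term (Sum.inl Func₀.c₁ : L₁.Functions 0)
abbrev c₂Term : L₁.Term α := Constants.term (Sum.inl Func₀.c₂ : L₁.Functions 0)
abbrev c₃Term : L₁.Term α := Constants.term (Sum.inl Func₀.c₃ : L₁.Functions 0)
abbrev c₄Term : L₁.Term α := Constants.term (Sum.inl Func₀.c₄ : L₁.Functions 0)
def STerm (t : L₁.Term α) : L₁.Term α := Functions.apply₁ (L := L₁) (Sum.inl Func₀.S) t
def PTerm (t : L₁.Term α) : L₁.Term α := Functions.apply₁ (L := L₁) (Sum.inl Func₀.P) t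
def πTerm (t : L₁.Term α) : L₁.Term α := Functions.apply₁ (L := L₁) (Sum.inl Func₀.π) t
def fTerm (t : L₁.Term α) : L₁.Term α := Functions.apply₁ (L := L₁) (Sum.inr FuncFG.f) t
def gTerm (t : L₁.Term α) : L₁.Term α := Functions.apply₁ (L := L₁) (Sum.inr FuncFG.g) t

variable {n : ℕ}

def ZFormula (t : L₁.Term (α ⊕ Fin n)) : L₁.BoundedFormula α n :=
  Relations.boundedFormula₁ (L := L₁) (Sum.inl Rel₀.Z) t

def ltFormula (t s : L₁.Term (α ⊕ Fin n)) : L₁.BoundedFormula α n :=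
  Relations.boundedFormula₂ (L := L₁) (Sum.inl Rel₀.lt) t s

def leFormula (t s : L₁.Term (α ⊕ Fin n)) : L₁.BoundedFormula α n :=
  ltFormula t s ⊔ t =' s

variable {M : Type u} [𝓜 : L₁.Structure M] (v : α → M) (t s : L₁.Term α)

theorem realize_c₁Term : (c₁Term : L₁.Term α).realize v = c₁ (reduct₀ 𝓜) :=
  Term.realize_constants

theorem realize_c₂Term : (c₂Term : L₁.Term α).realize v = c₂ (reduct₀ 𝓜) :=
  Term.realize_constants

theorem realize_c₃Term : (c₃Term : L₁.Term α).realize v = c₃ (reduct₀ 𝓜) :=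
  Term.realize_constants

theorem realize_c₄Term : (c₄Term : L₁.Term α).realize v = c₄ (reduct₀ 𝓜) :=
  Term.realize_constants

theorem realize_STerm : (STerm t).realize v = S (reduct₀ 𝓜) (t.realize v) :=
  Term.realize_functions_apply₁

theorem realize_PTerm : (PTerm t).realize v = P (reduct₀ 𝓜) (t.realize v) :=
  Term.realize_functions_apply₁

theorem realize_πTerm : (πTerm t).realize v = π (reduct₀ 𝓜) (t.realize v) :=
  Term.realize_functions_apply₁

theorem realize_fTerm : (fTerm t).realize v = f 𝓜 (t.realize v) :=
  Term.realize_functions_apply₁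

theorem realize_gTerm : (gTerm t).realize v = g 𝓜 (t.realize v) :=
  Term.realize_functions_apply₁

theorem realize_iterate_STerm (k : ℕ) :
    (STerm^[k] t).realize v = (S (reduct₀ 𝓜))^[k] (t.realize v) := by
  induction k with
  | zero => rfl
  | succ k ih => simp only [Function.iterate_succ_apply', realize_STerm, ih]

theorem realize_iterate_PTerm (k : ℕ) :
    (PTerm^[k] t).realize v = (P (reduct₀ 𝓜))^[k] (t.realize v) := by
  induction k with
  | zero => rfl
  | succ k ih => simp only [Function.iterate_succ_apply', realize_PTerm, ih]

theorem realize_iterate_fTerm (k : ℕ) :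
    (fTerm^[k] t).realize v = (f 𝓜)^[k] (t.realize v) := by
  induction k with
  | zero => rfl
  | succ k ih => simp only [Function.iterate_succ_apply', realize_fTerm, ih]

theorem realize_ZFormula (xs : Fin n → M) (t : L₁.Term (α ⊕ Fin n)) :
    (ZFormula t).Realize v xs ↔ t.realize (Sum.elim v xs) ∈ Z (reduct₀ 𝓜) :=
  BoundedFormula.realize_rel₁

theorem realize_ltFormula (xs : Fin n → M) (t s : L₁.Term (α ⊕ Fin n)) :
    (ltFormula t s).Realize v xs ↔
      lt (reduct₀ 𝓜) (t.realize (Sum.elim v xs)) (s.realize (Sum.elim v xs)) :=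
  BoundedFormula.realize_rel₂

theorem realize_leFormula (xs : Fin n → M) (t s : L₁.Term (α ⊕ Fin n)) :
    (leFormula t s).Realize v xs ↔
      le (reduct₀ 𝓜) (t.realize (Sum.elim v xs)) (s.realize (Sum.elim v xs)) := by
  rw [leFormula, BoundedFormula.realize_sup, realize_ltFormula, BoundedFormula.realize_bdEqual, le]

end Terms

/-! ### First-order axiomatization and transfer between models. -/

section Transfer

variable {M : Type u} {N : Type v} [𝓜 : L₁.Structure M] [𝓝 : L₁.Structure N]

/-- The sentence `∀ x y, φ`. -/
abbrev all₂ (φ : L₁.BoundedFormula Empty 2) : L₁.Sentence := φ.all.all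

theorem realize_all₂ (φ : L₁.BoundedFormula Empty 2) :
    M ⊨ all₂ φ ↔ ∀ x y : M, φ.Realize default ![x, y] := by
  simp only [Sentence.Realize, Formula.Realize, BoundedFormula.realize_all]
  refine forall₂_congr fun x y => ?_
  congr!
  ext i
  fin_cases i <;> rfl

theorem realize_all₂_ex (φ : L₁.BoundedFormula Empty 3) :
    M ⊨ all₂ φ.ex ↔ ∀ x y : M, ∃ z, φ.Realize default ![x, y, z] := by
  simp only [realize_all₂, BoundedFormula.realize_ex]
  refine forall₂_congr fun x y => exists_congr fun z => ?_
  congr!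
  ext i
  fin_cases i <;> rfl

theorem realize_all₂_all (φ : L₁.BoundedFormula Empty 3) :
    M ⊨ all₂ φ.all ↔ ∀ x y z : M, φ.Realize default ![x, y, z] := by
  simp only [realize_all₂, BoundedFormula.realize_all]
  refine forall₂_congr fun x y => forall_congr' fun z => ?_
  congr!
  ext i
  fin_cases i <;> rfl

local notation "x₀" => (Term.var (Sum.inr 0))
local notation "x₁" => (Term.var (Sum.inr 1))
local notation "x₂" => (Term.var (Sum.inr 2))

theorem IsDLO.transfer (h : IsDLO (reduct₀ 𝓜)) (hN : ∀ σ : L₁.Sentence, M ⊨ σ → N ⊨ σ) :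
    IsDLO (reduct₀ 𝓝) := by
  have tr : ∀ φ : L₁.BoundedFormula Empty 2,
      (∀ x y : M, φ.Realize default ![x, y]) → ∀ x y : N, φ.Realize default ![x, y] :=
    fun φ hφ => (realize_all₂ φ).1 (hN _ ((realize_all₂ φ).2 hφ))
  have trex : ∀ φ : L₁.BoundedFormula Empty 3, (∀ x y : M, ∃ z, φ.Realize default ![x, y, z]) →
      ∀ x y : N, ∃ z, φ.Realize default ![x, y, z] :=
    fun φ hφ => (realize_all₂_ex φ).1 (hN _ ((realize_all₂_ex φ).2 hφ))
  have trall : ∀ φ : L₁.BoundedFormula Empty 3, (∀ x y z : M, φ.Realize default ![x, y, z]) →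
      ∀ x y z : N, φ.Realize default ![x, y, z] :=
    fun φ hφ => (realize_all₂_all φ).1 (hN _ ((realize_all₂_all φ).2 hφ))
  constructor
  · have := tr (∼(ltFormula x₀ x₀)) (by simpa [realize_ltFormula] using fun x _ => h.irrefl x)
    simpa [realize_ltFormula] using fun x => this x x
  · have := trall (ltFormula x₀ x₁ ⟹ ltFormula x₁ x₂ ⟹ ltFormula x₀ x₂)
      (by simpa [realize_ltFormula] using h.trans)
    simpa [realize_ltFormula] using this
  · have := tr (ltFormula x₀ x₁ ⊔ (x₀ =' x₁ ⊔ ltFormula x₁ x₀))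
      (by simpa [realize_ltFormula] using h.total)
    simpa [realize_ltFormula] using this
  · have := trex (ltFormula x₀ x₁ ⟹ (ltFormula x₀ x₂ ⊓ ltFormula x₂ x₁)) (by
      intro x y
      by_cases hxy : lt (reduct₀ 𝓜) x y
      · simpa [realize_ltFormula, hxy] using h.dense x y hxy
      · exact ⟨x, by simp [realize_ltFormula, hxy]⟩)
    intro x y hxy
    simpa [realize_ltFormula, hxy] using this x y
  · have := trex (ltFormula x₂ x₀) (by simpa [realize_ltFormula] using fun x _ => h.no_min x)
    simpa [realize_ltFormula] using fun x => this x x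
  · have := trex (ltFormula x₀ x₂) (by simpa [realize_ltFormula] using fun x _ => h.no_max x)
    simpa [realize_ltFormula] using fun x => this x x

/-- The finitely many single conditions form one sentence `∀ x y, …`. The three families indexed by
exponents give one sentence for each choice of exponents. -/
theorem isDefective_transfer (h : IsDLO (reduct₀ 𝓜)) (h' : IsDLO (reduct₀ 𝓝))
    (hM : letI := h.linearOrder; (rotationData 𝓜).IsDefective)
    (hN : ∀ σ : L₁.Sentence, M ⊨ σ → N ⊨ σ) :
    letI := h'.linearOrder; (rotationData 𝓝).IsDefective := by
  let := h.linearOrder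
  let := h'.linearOrder
  have tr : ∀ φ : L₁.BoundedFormula Empty 2,
      (∀ x y : M, φ.Realize default ![x, y]) → ∀ x y : N, φ.Realize default ![x, y] :=
    fun φ hφ => (realize_all₂ φ).1 (hN _ ((realize_all₂ φ).2 hφ))
  have key := tr (
    (ZFormula c₁Term) ⊓
    (ZFormula c₂Term) ⊓
    (ZFormula c₃Term) ⊓
    (ZFormula c₄Term) ⊓
    (ZFormula x₀ ⟹ leFormula c₁Term x₀) ⊓
    (ZFormula x₀ ⟹ leFormula x₀ c₄Term) ⊓
    (ltFormula c₂Term c₃Term) ⊓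
    (ZFormula x₀ ⟹ ZFormula (STerm x₀)) ⊓
    (PTerm (STerm x₀) =' x₀) ⊓
    (STerm (PTerm x₀) =' x₀) ⊓
    (STerm c₄Term =' c₁Term) ⊓
    (ZFormula x₀ ⟹ ∼(x₀ =' c₄Term) ⟹ ltFormula x₀ (STerm x₀)) ⊓
    (ZFormula x₀ ⟹ ZFormula x₁ ⟹ ltFormula x₀ x₁ ⟹ leFormula (STerm x₀) x₁) ⊓
    (∼(ZFormula x₀) ⟹ STerm x₀ =' x₀) ⊓
    (ZFormula (πTerm x₀)) ⊓
    (ZFormula x₀ ⟹ πTerm x₀ =' x₀) ⊓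
    (∼(ZFormula x₀) ⟹ ltFormula x₀ c₄Term ⟹ ltFormula x₀ (πTerm x₀)) ⊓
    (∼(ZFormula x₀) ⟹ ZFormula x₁ ⟹ ltFormula x₀ x₁ ⟹ leFormula (πTerm x₀) x₁) ⊓
    (ltFormula c₄Term x₀ ⟹ πTerm x₀ =' c₁Term) ⊓
    (ZFormula x₀ ⟹ ZFormula (fTerm x₀)) ⊓
    (ZFormula x₀ ⟹ ZFormula (gTerm x₀)) ⊓
    (∼(ZFormula x₀) ⟹ fTerm x₀ =' x₀) ⊓
    (∼(ZFormula x₀) ⟹ gTerm x₀ =' x₀) ⊓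
    (gTerm (fTerm x₀) =' x₀) ⊓
    (∼(x₀ =' PTerm c₃Term) ⟹ fTerm (gTerm x₀) =' x₀) ⊓
    (gTerm (PTerm c₃Term) =' c₁Term) ⊓
    (ZFormula x₀ ⟹ ∼(x₀ =' c₄Term) ⟹ fTerm (STerm x₀) =' STerm (fTerm x₀)) ⊓
    (ZFormula x₀ ⟹ leFormula x₀ c₂Term ⟹ leFormula c₃Term (fTerm x₀)) ⊓
    (ZFormula x₀ ⟹ ltFormula c₂Term x₀ ⟹ ltFormula (fTerm x₀) (PTerm c₃Term)) ⊓
    (ZFormula x₀ ⟹ ZFormula x₁ ⟹ leFormula x₁ c₂Term ⟹ ltFormula x₀ x₁ ⟹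
      ltFormula (fTerm x₀) (fTerm x₁)) ⊓
    (ZFormula x₀ ⟹ ZFormula x₁ ⟹ ltFormula c₂Term x₀ ⟹ ltFormula x₀ x₁ ⟹
      ltFormula (fTerm x₀) (fTerm x₁)))
    (fun x y => by
      simp only [realize_ZFormula, realize_ltFormula, realize_leFormula, realize_c₁Term,
        realize_c₂Term, realize_c₃Term, realize_c₄Term, realize_STerm, realize_PTerm, realize_πTerm,
        realize_fTerm, realize_gTerm, BoundedFormula.realize_imp, BoundedFormula.realize_not,
        BoundedFormula.realize_inf, BoundedFormula.realize_bdEqual, Term.realize_var, Sum.elim_inr,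
        Matrix.cons_val_zero, Matrix.cons_val_one, and_assoc]
      exact ⟨hM.c₁_mem, hM.c₂_mem, hM.c₃_mem, hM.c₄_mem, hM.c₁_le x, hM.le_c₄ x, hM.c₂_lt_c₃,
        hM.S_mem x, hM.P_S x, hM.S_P x, hM.S_c₄, hM.lt_S x, fun hx hy => hM.S_le x hx y hy,
        hM.S_of_notMem x, hM.π_mem x, hM.π_of_mem x, hM.lt_π x, fun hx hy => hM.π_le x hx y hy,
        hM.π_of_c₄_lt x, hM.f_mem x, hM.g_mem x, hM.f_of_notMem x, hM.g_of_notMem x, hM.g_f x,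
        hM.f_g x, hM.g_P_c₃, hM.f_S x, hM.c₃_le_f x, hM.f_lt x, fun hx hy => hM.f_lt_f_of_le x hx y
        hy, fun hx hy => hM.f_lt_f_of_lt x hx y hy⟩)
  simp only [realize_ZFormula, realize_ltFormula, realize_leFormula, realize_c₁Term, realize_c₂Term,
    realize_c₃Term, realize_c₄Term, realize_STerm, realize_PTerm, realize_πTerm, realize_fTerm,
    realize_gTerm, BoundedFormula.realize_imp, BoundedFormula.realize_not,
    BoundedFormula.realize_inf, BoundedFormula.realize_bdEqual, Term.realize_var, Sum.elim_inr,
    Matrix.cons_val_zero, Matrix.cons_val_one, and_assoc, forall_and] at key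
  have circular := fun n => tr (ZFormula x₀ ⟹
      ((ltFormula (fTerm^[n + 2] x₀) (fTerm x₀) ⊓ ltFormula (fTerm x₀) x₀) ⊔
        ((ltFormula (fTerm x₀) x₀ ⊓ ltFormula x₀ (fTerm^[n + 2] x₀)) ⊔
          (ltFormula x₀ (fTerm^[n + 2] x₀) ⊓ ltFormula (fTerm^[n + 2] x₀) (fTerm x₀)))))
    (fun x _ => by
      simp only [realize_ZFormula, realize_ltFormula, realize_fTerm, realize_iterate_fTerm,
    BoundedFormula.realize_imp, BoundedFormula.realize_inf, BoundedFormula.realize_sup,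
    Term.realize_var, Sum.elim_inr, Matrix.cons_val_zero]
      exact hM.circular n x)
  simp only [realize_ZFormula, realize_ltFormula, realize_fTerm, realize_iterate_fTerm,
    BoundedFormula.realize_imp, BoundedFormula.realize_inf, BoundedFormula.realize_sup,
    Term.realize_var, Sum.elim_inr, Matrix.cons_val_zero] at circular
  have iterate_f_ne_iterate_S := fun n k => tr (ZFormula x₀ ⟹ ∼(fTerm^[n + 1] x₀ =' STerm^[k] x₀))
    (fun x _ => by
      simp only [realize_ZFormula, realize_iterate_fTerm, realize_iterate_STerm,
    BoundedFormula.realize_imp, BoundedFormula.realize_not, BoundedFormula.realize_bdEqual,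
    Term.realize_var, Sum.elim_inr, Matrix.cons_val_zero]
      exact hM.iterate_f_ne_iterate_S n k x)
  simp only [realize_ZFormula, realize_iterate_fTerm, realize_iterate_STerm,
    BoundedFormula.realize_imp, BoundedFormula.realize_not, BoundedFormula.realize_bdEqual,
    Term.realize_var, Sum.elim_inr, Matrix.cons_val_zero] at iterate_f_ne_iterate_S
  have iterate_f_ne_iterate_P := fun n k => tr (ZFormula x₀ ⟹ ∼(fTerm^[n + 1] x₀ =' PTerm^[k] x₀))
    (fun x _ => by
      simp only [realize_ZFormula, realize_iterate_fTerm, realize_iterate_PTerm,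
    BoundedFormula.realize_imp, BoundedFormula.realize_not, BoundedFormula.realize_bdEqual,
    Term.realize_var, Sum.elim_inr, Matrix.cons_val_zero]
      exact hM.iterate_f_ne_iterate_P n k x)
  simp only [realize_ZFormula, realize_iterate_fTerm, realize_iterate_PTerm,
    BoundedFormula.realize_imp, BoundedFormula.realize_not, BoundedFormula.realize_bdEqual,
    Term.realize_var, Sum.elim_inr, Matrix.cons_val_zero] at iterate_f_ne_iterate_P
  obtain ⟨c₁_mem, c₂_mem, c₃_mem, c₄_mem, c₁_le, le_c₄, c₂_lt_c₃, S_mem, P_S, S_P, S_c₄, lt_S,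
    S_le, S_of_notMem, π_mem, π_of_mem, lt_π, π_le, π_of_c₄_lt, f_mem, g_mem, f_of_notMem,
    g_of_notMem, g_f, f_g, g_P_c₃, f_S, c₃_le_f, f_lt, f_lt_f_of_le, f_lt_f_of_lt⟩ := key
  exact {
    -- Variables that do not occur in a condition are instantiated arbitrarily.
    c₁_mem := c₁_mem (c₁ (reduct₀ 𝓝)) (c₁ (reduct₀ 𝓝))
    c₂_mem := c₂_mem (c₁ (reduct₀ 𝓝)) (c₁ (reduct₀ 𝓝))
    c₃_mem := c₃_mem (c₁ (reduct₀ 𝓝)) (c₁ (reduct₀ 𝓝))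
    c₄_mem := c₄_mem (c₁ (reduct₀ 𝓝)) (c₁ (reduct₀ 𝓝))
    c₁_le := fun x => c₁_le x x
    le_c₄ := fun x => le_c₄ x x
    c₂_lt_c₃ := c₂_lt_c₃ (c₁ (reduct₀ 𝓝)) (c₁ (reduct₀ 𝓝))
    S_mem := fun x => S_mem x x
    P_S := fun x => P_S x x
    S_P := fun x => S_P x x
    S_c₄ := S_c₄ (c₁ (reduct₀ 𝓝)) (c₁ (reduct₀ 𝓝))
    lt_S := fun x => lt_S x x
    S_le := fun x hx y hy => S_le x y hx hy
    S_of_notMem := fun x => S_of_notMem x x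
    π_mem := fun x => π_mem x x
    π_of_mem := fun x => π_of_mem x x
    lt_π := fun x => lt_π x x
    π_le := fun x hx y hy => π_le x y hx hy
    π_of_c₄_lt := fun x => π_of_c₄_lt x x
    f_mem := fun x => f_mem x x
    g_mem := fun x => g_mem x x
    f_of_notMem := fun x => f_of_notMem x x
    g_of_notMem := fun x => g_of_notMem x x
    g_f := fun x => g_f x x
    f_g := fun x => f_g x x
    g_P_c₃ := g_P_c₃ (c₁ (reduct₀ 𝓝)) (c₁ (reduct₀ 𝓝))
    f_S := fun x => f_S x x
    c₃_le_f := fun x => c₃_le_f x x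
    f_lt := fun x => f_lt x x
    f_lt_f_of_le := fun x hx y hy => f_lt_f_of_le x y hx hy
    f_lt_f_of_lt := fun x hx y hy => f_lt_f_of_lt x y hx hy
    circular := fun n x => circular n x x
    iterate_f_ne_iterate_S := fun n k x => iterate_f_ne_iterate_S n k x x
    iterate_f_ne_iterate_P := fun n k x => iterate_f_ne_iterate_P n k x x }

end Transfer

/-! ### Rotations, and why their modification is defective. -/

/-- The cyclic order of a linear order. -/
def Cyc {N : Type u} [LinearOrder N] (a b c : N) : Prop :=
  (a < b ∧ b < c) ∨ (b < c ∧ c < a) ∨ (c < a ∧ a < b)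

namespace RotationData

variable {N : Type u} [LinearOrder N] (A : RotationData N)

/-- `f` is a rotation of the discrete set `Z` all of whose powers move points infinitely far. -/
structure IsRotation : Prop extends A.IsDiscrete where
  infinite₃₄ : {z ∈ A.Z | A.c₃ < z ∧ z < A.c₄}.Infinite
  f_mem : ∀ z ∈ A.Z, A.f z ∈ A.Z
  f_of_notMem : ∀ x ∉ A.Z, A.f x = x
  g_f : ∀ x, A.g (A.f x) = x
  f_g : ∀ x, A.f (A.g x) = x
  f_S : ∀ x, A.f (A.S x) = A.S (A.f x)
  f_c₁ : A.f A.c₁ = A.c₃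
  f_c₂ : A.f A.c₂ = A.c₄
  c₃_le_f : ∀ z ∈ A.Z, z ≤ A.c₂ → A.c₃ ≤ A.f z
  f_lt_f_of_le : ∀ x ∈ A.Z, ∀ z ∈ A.Z, z ≤ A.c₂ → x < z → A.f x < A.f z
  f_lt_f_of_lt : ∀ x ∈ A.Z, ∀ z ∈ A.Z, A.c₂ < x → x < z → A.f x < A.f z
  circular : ∀ n, ∀ z ∈ A.Z, Cyc (A.f^[n + 2] z) (A.f z) z
  infinite_forward : ∀ n, 1 < n → ∀ z ∈ A.Z, {y ∈ A.Z | Cyc z y (A.f^[n] z)}.Infinite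
  infinite_backward : ∀ n, 1 < n → ∀ z ∈ A.Z, {y ∈ A.Z | Cyc (A.f^[n] z) y z}.Infinite

/-- The points at finite distance below `c`. -/
def Below {N : Type u} (A : RotationData N) (c x : N) : Prop := ∃ n : ℕ, A.S^[n] x = c

open scoped Classical in
/-- The modification of `f` and `g` by which `P c₃` drops out of the image of `f`. -/
noncomputable def modify : RotationData N :=
  { A with
    f := fun x => if A.Below A.c₄ x then A.P (A.f x) else A.f x
    g := fun x => if A.Below (A.P A.c₃) x then A.g (A.S x) else A.g x }

variable {A}

theorem below_S_iff {N : Type u} {A : RotationData N} {c x : N} (hx : x ≠ c) :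
    A.Below c (A.S x) ↔ A.Below c x := by
  constructor
  · rintro ⟨n, hn⟩
    exact ⟨n + 1, hn⟩
  · rintro ⟨_ | n, hn⟩
    · exact (hx hn).elim
    · exact ⟨n, hn⟩

namespace IsDiscrete

theorem iterate_S_mem (h : A.IsDiscrete) {z : N} (hz : z ∈ A.Z) (n : ℕ) : A.S^[n] z ∈ A.Z := by
  induction n with
  | zero => exact hz
  | succ n ih => rw [Function.iterate_succ_apply']; exact h.S_mem _ ih

theorem P_mem (h : A.IsDiscrete) {z : N} (hz : z ∈ A.Z) : A.P z ∈ A.Z := by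
  by_contra hP
  have := h.S_of_notMem _ hP
  rw [h.S_P] at this
  exact hP (this ▸ hz)

theorem iterate_P_mem (h : A.IsDiscrete) {z : N} (hz : z ∈ A.Z) (n : ℕ) : A.P^[n] z ∈ A.Z := by
  induction n with
  | zero => exact hz
  | succ n ih => rw [Function.iterate_succ_apply']; exact h.P_mem ih

theorem leftInverse (h : A.IsDiscrete) (n : ℕ) : Function.LeftInverse A.S^[n] A.P^[n] :=
  Function.LeftInverse.iterate h.S_P n

theorem S_injective (h : A.IsDiscrete) : Function.Injective A.S :=
  Function.LeftInverse.injective h.P_S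

theorem eq_or_cyc_of_cyc_S (h : A.IsDiscrete) {x z w : N} (hx : x ∈ A.Z) (hz : z ∈ A.Z)
    (hw : w ∈ A.Z)    (hc : Cyc x z (A.S w)) : z = w ∨ Cyc x z w := by
  unfold Cyc at *
  have h1 := h.S_le w hw x hx
  have h2 := h.S_le w hw z hz
  have h3 := h.lt_S w hw
  have h4 := h.S_c₄
  have h5 := h.c₁_le x hx
  have h6 := h.c₁_le z hz
  have h7 := h.le_c₄ x hx
  have h8 := h.le_c₄ z hz
  by_cases hw4 : w = A.c₄
  · subst hw4
    rw [h4] at hc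
    grind
  · grind

theorem eq_iterate_of_cyc (h : A.IsDiscrete) {x z : N} (hx : x ∈ A.Z) (hz : z ∈ A.Z) (n : ℕ)
    (hc : Cyc x z (A.S^[n] x)) : ∃ i ≤ n, z = A.S^[i] x := by
  induction n with
  | zero =>
    unfold Cyc at hc
    simp only [Function.iterate_zero, id] at hc
    grind
  | succ n ih =>
    rw [Function.iterate_succ_apply'] at hc
    rcases h.eq_or_cyc_of_cyc_S hx hz (h.iterate_S_mem hx n) hc with h' | h'
    · exact ⟨n, n.le_succ, h'⟩
    · obtain ⟨i, hi, h'⟩ := ih h'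
      exact ⟨i, hi.trans n.le_succ, h'⟩

/-- Converts the infinitude axioms into statements that `S`-chains are different. -/
theorem finite_cyc (h : A.IsDiscrete) {x : N} (hx : x ∈ A.Z) (n : ℕ) :
    {y ∈ A.Z | Cyc x y (A.S^[n] x)}.Finite := by
  refine ((Set.finite_Iic n).image fun i => A.S^[i] x).subset ?_
  rintro y ⟨hy, hc⟩
  obtain ⟨i, hi, rfl⟩ := h.eq_iterate_of_cyc hx hy n hc
  exact ⟨i, hi, rfl⟩

/-- One step backwards from `a` can destroy the cyclic order only by landing on `c`, the first of
the two other points met in that direction. -/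
theorem cyc_P_left (h : A.IsDiscrete) {a b c : N} (ha : a ∈ A.Z) (hb : b ∈ A.Z) (hc : c ∈ A.Z)
    (hne : A.P a ≠ c)    (h' : Cyc a b c) : Cyc (A.P a) b c := by
  have hP := h.P_mem ha
  have h1 := h.S_le _ hP b hb
  have h2 := h.S_le _ hP c hc
  have h3 := h.lt_S _ hP
  have h4 := h.S_c₄
  have h5 := h.c₁_le b hb
  have h6 := h.c₁_le c hc
  have h7 := h.le_c₄ b hb
  have h8 := h.le_c₄ c hc
  rw [h.S_P] at h1 h2 h3
  unfold Cyc at *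
  by_cases hw : A.P a = A.c₄
  · have h9 : a = A.c₁ := by rw [← h.S_P a, hw, h4]
    rw [hw] at hne ⊢
    subst h9
    grind
  · grind

theorem cyc_iterate_P_left (h : A.IsDiscrete) {a b c : N} (ha : a ∈ A.Z) (hb : b ∈ A.Z)
    (hc : c ∈ A.Z) (hne : ∀ j, A.P^[j] a ≠ c) (h' : Cyc a b c) (j : ℕ) : Cyc (A.P^[j] a) b c := by
  induction j with
  | zero => exact h'
  | succ j ih =>
    have := hne (j + 1)
    rw [Function.iterate_succ_apply'] at this ⊢
    exact h.cyc_P_left (h.iterate_P_mem ha j) hb hc this ih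

theorem mem_of_below (h : A.IsDiscrete) {c x : N} (hc : c ∈ A.Z) (hx : A.Below c x) : x ∈ A.Z := by
  by_contra hx'
  obtain ⟨n, hn⟩ := hx
  rw [Function.iterate_fixed (h.S_of_notMem x hx')] at hn
  exact hx' (hn ▸ hc)

end IsDiscrete

theorem cyc_rotate {a b c : N} : Cyc a b c → Cyc b c a := by
  unfold Cyc
  tauto

namespace IsRotation

theorem commute_f_S (h : A.IsRotation) : Function.Commute A.f A.S := h.f_S

theorem f_P (h : A.IsRotation) (x : N) : A.f (A.P x) = A.P (A.f x) := by
  apply h.S_injective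
  rw [← h.f_S, h.S_P, h.S_P]

theorem iterate_f_mem (h : A.IsRotation) {z : N} (hz : z ∈ A.Z) (n : ℕ) : A.f^[n] z ∈ A.Z := by
  induction n with
  | zero => exact hz
  | succ n ih => rw [Function.iterate_succ_apply']; exact h.f_mem _ ih

theorem iterate_f_iterate_S (h : A.IsRotation) (n k : ℕ) (z : N) :
    A.f^[n] (A.S^[k] z) = A.S^[k] (A.f^[n] z) :=
  (h.commute_f_S.iterate_iterate n k) z

theorem iterate_ne (h : A.IsRotation) (n a b : ℕ) {z : N} (hz : z ∈ A.Z) :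
    A.S^[a] (A.f^[n + 1] z) ≠ A.S^[b] z := by
  intro e
  rcases le_total a b with hab | hab
  · obtain ⟨k, rfl⟩ := Nat.exists_eq_add_of_le hab
    rw [Function.iterate_add_apply A.S] at e
    have e := h.S_injective.iterate a e
    -- The infinitude axioms hold only for exponents greater than 1. Doubling the exponent covers `n
    -- = 0`: if `f^(n+1)` moves `z` by `k` steps, its square moves `z` by `k + k`.
    refine h.infinite_forward ((n + 1) + (n + 1)) (by lia) z hz ?_
    rw [Function.iterate_add_apply, e, h.iterate_f_iterate_S, e, ← Function.iterate_add_apply]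
    exact h.finite_cyc hz _
  · obtain ⟨k, rfl⟩ := Nat.exists_eq_add_of_le hab
    rw [Function.iterate_add_apply A.S] at e
    have e := h.S_injective.iterate b e
    refine h.infinite_backward ((n + 1) + (n + 1)) (by lia) z hz ?_
    have : A.S^[k + k] (A.f^[(n + 1) + (n + 1)] z) = z := by
      rw [Function.iterate_add_apply, Function.iterate_add_apply, ← h.iterate_f_iterate_S, e, e]
    have hfin := h.finite_cyc (h.iterate_f_mem hz ((n + 1) + (n + 1))) (k + k)
    rwa [this] at hfin

theorem f_c₄ (h : A.IsRotation) : A.f A.c₄ = A.P A.c₃ := by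
  rw [← h.f_c₁, ← h.S_c₄, h.f_S, h.P_S]

theorem f_S_c₂ (h : A.IsRotation) : A.f (A.S A.c₂) = A.c₁ := by
  rw [h.f_S, h.f_c₂, h.S_c₄]

/-- Otherwise the infinitely many points between `c₃` and `c₄` would lie in a finite arc. Thus `f`
is modified only beyond `c₂`, inside one of its two pieces. -/
theorem c₃_lt_of_below (h : A.IsRotation) {x : N} (hx : A.Below A.c₄ x) : A.c₃ < x := by
  have hxZ := h.mem_of_below h.c₄_mem hx
  obtain ⟨n, hn⟩ := hx
  by_contra hle
  refine h.infinite₃₄ ((h.finite_cyc hxZ n).subset ?_)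
  rintro y ⟨hy, h1, h2⟩
  exact ⟨hy, hn ▸ .inl ⟨(not_lt.1 hle).trans_lt h1, h2⟩⟩

/-- A point between a point below `c₄` at finite distance and `c₄` is at finite distance. -/
theorem below_of_le (h : A.IsRotation) {x y : N} (hx : A.Below A.c₄ x) (hy : y ∈ A.Z)
    (hxy : x ≤ y) : A.Below A.c₄ y := by
  have hxZ := h.mem_of_below h.c₄_mem hx
  rcases hxy.eq_or_lt with rfl | hxy
  · exact hx
  rcases (h.le_c₄ y hy).eq_or_lt with rfl | hy4
  · exact ⟨0, rfl⟩
  obtain ⟨n, hn⟩ := hx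
  obtain ⟨i, hi, rfl⟩ := h.eq_iterate_of_cyc hxZ hy n (hn ▸ .inl ⟨hxy, hy4⟩)
  refine ⟨n - i, ?_⟩
  rw [← Function.iterate_add_apply, Nat.sub_add_cancel hi, hn]

theorem below_f_iff (h : A.IsRotation) {x : N} :
    A.Below (A.P A.c₃) (A.f x) ↔ A.Below A.c₄ x := by
  refine exists_congr fun n => ?_
  rw [show A.S^[n] (A.f x) = A.f (A.S^[n] x) from (h.iterate_f_iterate_S 1 n x).symm, ← h.f_c₄]
  exact (Function.LeftInverse.injective h.g_f).eq_iff

open scoped Classical in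
-- Each application of the modified map adds at most one `P`, and `P` commutes with the original
-- `f`.
theorem exists_iterate_modify_f_eq (h : A.IsRotation) (n : ℕ) (z : N) :
    ∃ j, A.modify.f^[n] z = A.P^[j] (A.f^[n] z) := by
  have hcomm : Function.Commute A.f A.P := h.f_P
  induction n with
  | zero => exact ⟨0, rfl⟩
  | succ n ih =>
    obtain ⟨j, hj⟩ := ih
    have h1 : A.f (A.P^[j] (A.f^[n] z)) = A.P^[j] (A.f (A.f^[n] z)) :=
      (hcomm.iterate_iterate 1 j) _
    by_cases hb : A.Below A.c₄ (A.P^[j] (A.f^[n] z))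
    · refine ⟨j + 1, ?_⟩
      rw [Function.iterate_succ_apply', hj, Function.iterate_succ_apply',
        Function.iterate_succ_apply' A.f, ← h1]
      exact if_pos hb
    · refine ⟨j, ?_⟩
      rw [Function.iterate_succ_apply', hj, Function.iterate_succ_apply' A.f, ← h1]
      exact if_neg hb

/-- Moving the values of the iterates of `f` by finite distances preserves the cyclic order. -/
theorem circular_iterate_P (h : A.IsRotation) (n i j : ℕ) {z : N} (hz : z ∈ A.Z) :
    Cyc (A.P^[j] (A.f^[n + 2] z)) (A.P^[i] (A.f z)) z := by
  have h1 := h.iterate_f_mem hz (n + 2)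
  have h2 := h.f_mem z hz
  have h3 := h.cyc_iterate_P_left h1 h2 hz (fun j e => ?_) (h.circular n z hz) j
  · have h4 := h.cyc_iterate_P_left h2 hz (h.iterate_P_mem h1 j) (fun i e => ?_)
      (cyc_rotate h3) i
    · exact cyc_rotate (cyc_rotate h4)
    · have e := congrArg (A.S^[i] ∘ A.S^[j]) e
      have hcomm : Function.Commute A.S^[i] A.S^[j] :=
        (Function.Commute.refl A.S).iterate_iterate i j
      simp only [Function.comp_apply] at e
      rw [h.leftInverse j, hcomm, h.leftInverse i] at e
      exact h.iterate_ne n i j h2 e.symm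
  · have e := congrArg A.S^[j] e
    rw [h.leftInverse j] at e
    exact h.iterate_ne (n + 1) 0 j hz e

theorem iterate_modify_f_ne (h : A.IsRotation) (n a b : ℕ) {z : N} (hz : z ∈ A.Z) :
    A.S^[a] (A.modify.f^[n + 1] z) ≠ A.S^[b] z := by
  obtain ⟨j, hj⟩ := h.exists_iterate_modify_f_eq (n + 1) z
  rw [hj]
  intro e
  have e := congrArg A.S^[j] e
  have hcomm : Function.Commute A.S^[j] A.S^[a] :=
    (Function.Commute.refl A.S).iterate_iterate j a
  rw [hcomm, h.leftInverse j, ← Function.iterate_add_apply] at e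
  exact h.iterate_ne n a (j + b) hz e

theorem P_lt (h : A.IsRotation) {z : N} (hz : z ∈ A.Z) (hne : z ≠ A.c₁) : A.P z < z := by
  have := h.lt_S (A.P z) (h.P_mem hz) fun e => hne (by rw [← h.S_P z, e, h.S_c₄])
  rwa [h.S_P] at this

open scoped Classical in
/-- The modification of a rotation is a defective rotation. -/
theorem isDefective_modify (h : A.IsRotation) : A.modify.IsDefective := by
  have hf : ∀ x, A.modify.f x = if A.Below A.c₄ x then A.P (A.f x) else A.f x := fun _ => rfl
  have hg : ∀ x, A.modify.g x = if A.Below (A.P A.c₃) x then A.g (A.S x) else A.g x :=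
    fun _ => rfl
  have hgZ : ∀ z ∈ A.Z, A.g z ∈ A.Z := fun z hz => by
    by_contra hn
    have := h.f_of_notMem _ hn
    rw [h.f_g] at this
    exact hn (this ▸ hz)
  have hPc₃ := h.P_mem h.c₃_mem
  have hc : ∀ x, A.Below A.c₄ x → A.c₂ < x := fun x hx =>
    h.c₂_lt_c₃.trans (h.c₃_lt_of_below hx)
  -- This keeps `P` from wrapping around: the preimage of `c₁` is `S c₂`, which is not at finite
  -- distance below `c₄`.
  have hfc₁ : ∀ x, A.Below A.c₄ x → A.f x ≠ A.c₁ := fun x hx e => by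
    have : x = A.S A.c₂ := by rw [← h.g_f x, e, ← h.f_S_c₂, h.g_f]
    subst this
    exact (hc A.c₂ ((below_S_iff (h.c₂_lt_c₃.trans_le (h.le_c₄ _ h.c₃_mem)).ne).1 hx)).false
  have hflt : ∀ x ∈ A.Z, A.Below A.c₄ x → A.P (A.f x) < A.f x := fun x hx hb =>
    h.P_lt (h.f_mem x hx) (hfc₁ x hb)
  refine { h.toIsDiscrete with
    f_mem := fun z hz => ?_
    g_mem := fun z hz => ?_
    f_of_notMem := fun x hx => ?_
    g_of_notMem := fun x hx => ?_
    g_f := fun x => ?_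
    f_g := fun z hz => ?_
    g_P_c₃ := ?_
    f_S := fun z hz hne => ?_
    c₃_le_f := fun z hz hle => ?_
    f_lt := fun z hz hlt => ?_
    f_lt_f_of_le := fun x hx z hz hle hlt => ?_
    f_lt_f_of_lt := fun x hx z hz hlt hlt' => ?_
    circular := fun n z hz => ?_
    iterate_f_ne_iterate_S := fun n k z hz => ?_
    iterate_f_ne_iterate_P := fun n k z hz => ?_ }
  · rw [hf]
    split_ifs
    · exact h.P_mem (h.f_mem z hz)
    · exact h.f_mem z hz
  · rw [hg]
    split_ifs
    · exact hgZ _ (h.S_mem z hz)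
    · exact hgZ z hz
  · rw [hf, if_neg fun hb => hx (h.mem_of_below h.c₄_mem hb)]
    exact h.f_of_notMem x hx
  · rw [hg, if_neg fun hb => hx (h.mem_of_below hPc₃ hb)]
    have := h.g_f x
    rwa [h.f_of_notMem x hx] at this
  · rw [hf, hg]
    split_ifs with h1 h2 h2
    · rw [h.S_P, h.g_f]
    · obtain ⟨n, hn⟩ := h.below_f_iff.2 h1
      refine (h2 ⟨n + 1, ?_⟩).elim
      rw [Function.iterate_succ_apply, h.S_P, hn]
    · exact (h1 (h.below_f_iff.1 h2)).elim
    · exact h.g_f x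
  · rw [hg]
    split_ifs with h1
    · have h2 : A.Below A.c₄ (A.g (A.S z)) := by
        rw [← h.below_f_iff, h.f_g]
        exact (below_S_iff hz).2 h1
      rw [hf, if_pos h2, h.f_g, h.P_S]
    · rw [hf, if_neg fun h2 => h1 ?_, h.f_g]
      rwa [← h.below_f_iff, h.f_g] at h2
  · change A.modify.g (A.P A.c₃) = A.c₁
    rw [hg, if_pos ⟨0, rfl⟩, h.S_P, ← h.f_c₁, h.g_f]
  · change A.modify.f (A.S z) = A.S (A.modify.f z)
    have hS : A.Below A.c₄ (A.S z) ↔ A.Below A.c₄ z := below_S_iff hne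
    rw [hf, hf]
    simp only [hS]
    split_ifs
    · rw [h.f_S, h.S_P, h.P_S]
    · exact h.f_S z
  · rw [hf, if_neg fun hb => (hc z hb).not_ge hle]
    exact h.c₃_le_f z hz hle
  · change A.modify.f z < A.P A.c₃
    rw [← h.f_c₄, hf]
    have h4 := h.le_c₄ z hz
    have hle : A.f z ≤ A.f A.c₄ := by
      rcases h4.eq_or_lt with rfl | h4
      · exact le_rfl
      · exact (h.f_lt_f_of_lt z hz _ h.c₄_mem hlt h4).le
    split_ifs with hb
    · exact (hflt z hz hb).trans_le hle
    · exact h.f_lt_f_of_lt z hz _ h.c₄_mem hlt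
        (lt_of_le_of_ne h4 fun e => hb (e ▸ ⟨0, rfl⟩))
  · rw [hf, hf, if_neg fun hb => (hc z hb).not_ge hle,
      if_neg fun hb => (hc x hb).not_ge (hlt.le.trans hle)]
    exact h.f_lt_f_of_le x hx z hz hle hlt
  · have hfxz := h.f_lt_f_of_lt x hx z hz hlt hlt'
    rw [hf, hf]
    split_ifs with h1 h2 h2
    · rcases lt_trichotomy (A.P (A.f x)) (A.P (A.f z)) with h' | h' | h'
      · exact h'
      · exact (hfxz.ne (by rw [← h.S_P (A.f x), h', h.S_P])).elim
      · have := h.S_le _ (h.P_mem (h.f_mem z hz)) _ (h.P_mem (h.f_mem x hx)) h'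
        rw [h.S_P] at this
        exact ((this.trans_lt (hflt x hx h1)).not_gt hfxz).elim
    · exact (h2 (h.below_of_le h1 hz hlt'.le)).elim
    -- Only `f z` is lowered. A collision `f x = P (f z)` would make `z` the successor of `x`, and
    -- `x` would be at finite distance below `c₄` as well.
    · rcases lt_trichotomy (A.f x) (A.P (A.f z)) with h' | h' | h'
      · exact h'
      · refine (h1 ((below_S_iff (hlt'.trans_le (h.le_c₄ z hz)).ne).1 ?_)).elim
        rwa [← h.g_f (A.S x), h.f_S, h', h.S_P, h.g_f]
      · have := h.S_le _ (h.P_mem (h.f_mem z hz)) _ (h.f_mem x hx) h'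
        rw [h.S_P] at this
        exact (this.not_gt hfxz).elim
    · exact hfxz
  · obtain ⟨j, hj⟩ := h.exists_iterate_modify_f_eq (n + 2) z
    obtain ⟨i, hi⟩ := h.exists_iterate_modify_f_eq 1 z
    have := h.circular_iterate_P n i j hz
    rw [hj]
    change A.modify.f z = A.P^[i] (A.f z) at hi
    rw [hi]
    have := h.circular_iterate_P n i j hz
    unfold Cyc at this
    tauto
  · exact h.iterate_modify_f_ne n 0 k hz
  · intro e
    have e := congrArg A.S^[k] e
    refine h.iterate_modify_f_ne n k 0 hz (e.trans ?_)
    exact h.leftInverse k z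

end IsRotation

end RotationData

/-! ### Models of `T₁` carry a rotation. -/

open RotationData

theorem ModelsT₀.isDiscrete {M : Type u} {𝓜 : L₁.Structure M} (h : ModelsT₀ (reduct₀ 𝓜)) :
    letI := h.dlo.linearOrder; (rotationData 𝓜).IsDiscrete := by
  let := h.dlo.linearOrder
  set A := rotationData 𝓜 with hA
  have h1 : A.c₁ ∈ A.Z := h.c₁_mem
  have h2 : A.c₂ ∈ A.Z := h.c₂_mem
  have h3 : A.c₃ ∈ A.Z := h.c₃_mem
  have h4 : A.c₄ ∈ A.Z := h.c₄_mem
  have hc₁ : ∀ z ∈ A.Z, A.c₁ ≤ z := h.c₁_le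
  have hc₄ : ∀ z ∈ A.Z, z ≤ A.c₄ := h.le_c₄
  have h12 : A.c₁ < A.c₂ := h.c₁_lt_c₂
  have h23 : A.c₂ < A.c₃ := h.c₂_lt_c₃
  have hS : ∀ x y, A.S x = y ↔ (x ∉ A.Z ∧ x = y) ∨
      (x ∈ A.Z ∧ y ∈ A.Z ∧ x ≠ y ∧ ¬ ∃ z ∈ A.Z, Cyc x z y) := h.S_eq_iff
  have hS' : ∀ x ∈ A.Z, A.S x ∈ A.Z ∧ x ≠ A.S x ∧ ∀ z ∈ A.Z, ¬ Cyc x z (A.S x) := fun x hx => by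
    have := (hS x _).1 rfl
    push Not at this
    rcases this with ⟨h', -⟩ | ⟨-, h', h'', h'''⟩
    · exact (h' hx).elim
    · exact ⟨h', h'', h'''⟩
  have hπ : ∀ x, A.π x ∈ A.Z := h.π_mem
  have hπ' : ∀ x, ∀ y ∈ A.Z, ¬ Cyc x y (A.π x) := h.π_between
  have hlt : ∀ z ∈ A.Z, z ≠ A.c₄ → z < A.S z := fun z hz hne => by
    obtain ⟨h5, h6, h7⟩ := hS' z hz
    have := h7 _ h4
    have := hc₄ z hz
    unfold Cyc at *
    grind
  refine ⟨h1, h2, h3, h4, hc₁, hc₄, h23, fun z hz => (hS' z hz).1, h.P_S, h.S_P, ?_, hlt, ?_,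
    fun x hx => (hS x x).2 (.inl ⟨hx, rfl⟩), hπ, h.π_of_mem, ?_, ?_, ?_⟩
  · obtain ⟨h5, h6, h7⟩ := hS' _ h4
    have := h7 _ h1
    have := hc₁ _ h5
    have := hc₄ _ h5
    unfold Cyc at *
    grind
  · intro x hx z hz hxz
    obtain ⟨h5, h6, h7⟩ := hS' x hx
    have := h7 z hz
    unfold Cyc at *
    grind
  · intro x hx hlt
    have := hπ' x _ h4
    have : A.π x ≠ x := fun e => hx (e ▸ hπ x)
    unfold Cyc at *
    grind
  · intro x hx z hz hxz
    have := hπ' x z hz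
    unfold Cyc at *
    grind
  · intro x hx
    have := hπ' x _ h1
    have := hc₁ _ (hπ x)
    have := hc₄ _ (hπ x)
    unfold Cyc at *
    grind

/-- The point at issue is that `f` commutes with `S`. Order isomorphisms between the pieces preserve
immediate successors. At the two seams, `c₂` goes to `c₄` and the next point to `c₁`, while `c₄`
goes to the last point before `c₃` and `c₁` to `c₃`. -/
theorem ModelsT₁.isRotation {M : Type u} {𝓜 : L₁.Structure M} (h : ModelsT₁ 𝓜) :
    letI := h.models₀.dlo.linearOrder; (rotationData 𝓜).IsRotation := by
  have hD := h.models₀.isDiscrete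
  let := h.models₀.dlo.linearOrder
  set A := rotationData 𝓜 with hA
  have h34 : A.c₃ < A.c₄ := h.models₀.c₃_lt_c₄
  have him : ∀ y, (y ∈ A.Z ∧ A.c₃ ≤ y ∧ y ≤ A.c₄) ↔
      ∃ x, (x ∈ A.Z ∧ A.c₁ ≤ x ∧ x ≤ A.c₂) ∧ A.f x = y :=
    fun y => (Set.ext_iff.1 h.image₁₂ y).symm
  have him' : ∀ y, (y ∈ A.Z ∧ A.c₁ ≤ y ∧ y < A.c₃) ↔
      ∃ x, (x ∈ A.Z ∧ A.c₂ < x ∧ x ≤ A.c₄) ∧ A.f x = y :=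
    fun y => (Set.ext_iff.1 h.image₂₄ y).symm
  have hle : ∀ x ∈ A.Z, x ≤ A.c₂ → A.f x ∈ A.Z ∧ A.c₃ ≤ A.f x ∧ A.f x ≤ A.c₄ :=
    fun x hx hxc => (him _).2 ⟨x, ⟨hx, hD.c₁_le x hx, hxc⟩, rfl⟩
  have hlt : ∀ x ∈ A.Z, A.c₂ < x → A.f x ∈ A.Z ∧ A.c₁ ≤ A.f x ∧ A.f x < A.c₃ :=
    fun x hx hxc => (him' _).2 ⟨x, ⟨hx, hxc, hD.le_c₄ x hx⟩, rfl⟩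
  have hiso : ∀ x ∈ A.Z, ∀ z ∈ A.Z, x ≤ A.c₂ → z ≤ A.c₂ → (x < z ↔ A.f x < A.f z) :=
    fun x hx z hz h1 h2 => h.iso₁₂ x ⟨hx, hD.c₁_le x hx, h1⟩ z ⟨hz, hD.c₁_le z hz, h2⟩
  have hiso' : ∀ x ∈ A.Z, ∀ z ∈ A.Z, A.c₂ < x → A.c₂ < z → (x < z ↔ A.f x < A.f z) :=
    fun x hx z hz h1 h2 => h.iso₂₄ x ⟨hx, h1, hD.le_c₄ x hx⟩ z ⟨hz, h2, hD.le_c₄ z hz⟩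
  have hfZ : ∀ z ∈ A.Z, A.f z ∈ A.Z := fun z hz => by
    rcases le_or_gt z A.c₂ with h' | h'
    · exact (hle z hz h').1
    · exact (hlt z hz h').1
  have hfc₁ : A.f A.c₁ = A.c₃ := by
    obtain ⟨w, ⟨hw, hw1, hw2⟩, e⟩ := (him A.c₃).1 ⟨hD.c₃_mem, le_rfl, h34.le⟩
    have h1 := hiso _ hD.c₁_mem w hw (hD.c₁_le _ hD.c₂_mem) hw2
    have h2 := hle _ hD.c₁_mem (hD.c₁_le _ hD.c₂_mem)
    rcases hw1.eq_or_lt with rfl | hw1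
    · exact e
    · rw [e] at h1
      exact ((h1.1 hw1).not_ge h2.2.1).elim
  have hfc₂ : A.f A.c₂ = A.c₄ := by
    obtain ⟨w, ⟨hw, hw1, hw2⟩, e⟩ := (him A.c₄).1 ⟨hD.c₄_mem, h34.le, le_rfl⟩
    have h1 := hiso w hw _ hD.c₂_mem hw2 le_rfl
    have h2 := hle _ hD.c₂_mem le_rfl
    rcases hw2.eq_or_lt with rfl | hw2
    · exact e
    · rw [e] at h1
      exact ((h1.1 hw2).not_ge h2.2.2).elim
  have hfn : ∀ x ∉ A.Z, A.f x = x := h.f_of_not_mem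
  have h24 : A.c₂ < A.c₄ := hD.c₂_lt_c₃.trans h34
  have hS₂ : A.c₂ < A.S A.c₂ := hD.lt_S _ hD.c₂_mem h24.ne
  have hsucc : ∀ a b, a ∈ A.Z → b ∈ A.Z → a < b → (∀ z ∈ A.Z, a < z → b ≤ z) → b = A.S a :=
    fun a b ha hb hab hz => le_antisymm
      (hz _ (hD.S_mem a ha) (hD.lt_S a ha (hab.trans_le (hD.le_c₄ b hb)).ne))
      (hD.S_le a ha b hb hab)
  have hfS : ∀ x, A.f (A.S x) = A.S (A.f x) := fun x => by
    by_cases hx : x ∈ A.Z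
    · rcases lt_trichotomy x A.c₂ with hxc | rfl | hxc
      · have hxS := hD.lt_S x hx (hxc.trans h24).ne
        have hSx := hD.S_le x hx _ hD.c₂_mem hxc
        have hSZ := hD.S_mem x hx
        refine hsucc _ _ (hfZ x hx) (hfZ _ hSZ)
          ((hiso x hx _ hSZ hxc.le hSx).1 hxS) fun z hz hlt' => ?_
        obtain ⟨w, ⟨hw, hw1, hw2⟩, rfl⟩ := (him z).1
          ⟨hz, (hle x hx hxc.le).2.1.trans hlt'.le, hD.le_c₄ z hz⟩
        have h1 := (hiso x hx w hw hxc.le hw2).2 hlt'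
        exact not_lt.1 fun h2 => ((hiso w hw _ hSZ hw2 hSx).2 h2).not_ge (hD.S_le x hx w hw h1)
      · rw [hfc₂, hD.S_c₄]
        obtain ⟨w, ⟨hw, hw1, hw2⟩, e⟩ := (him' A.c₁).1 ⟨hD.c₁_mem, le_rfl,
          (hD.c₁_le _ hD.c₂_mem).trans_lt hD.c₂_lt_c₃⟩
        have hSZ := hD.S_mem _ hx
        rcases (hD.S_le _ hx w hw hw1).eq_or_lt with h' | h'
        · rw [h', e]
        · have := (hiso' _ hSZ w hw hS₂ hw1).1 h'
          rw [e] at this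
          exact (this.not_ge (hD.c₁_le _ (hfZ _ hSZ))).elim
      · have hSZ := hD.S_mem x hx
        rcases (hD.le_c₄ x hx).eq_or_lt with rfl | hx4
        · rw [hD.S_c₄, hfc₁]
          have h1 := (hlt _ hx hxc)
          refine hsucc _ _ h1.1 hD.c₃_mem h1.2.2 fun z hz hlt' => not_lt.1 fun h2 => ?_
          obtain ⟨w, ⟨hw, hw1, hw2⟩, rfl⟩ := (him' z).1 ⟨hz, hD.c₁_le z hz, h2⟩
          exact ((hiso' _ hx w hw hxc hw1).2 hlt').not_ge hw2
        · have hxS := hD.lt_S x hx hx4.ne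
          have hSx := hxc.trans hxS
          refine hsucc _ _ (hfZ x hx) (hfZ _ hSZ)
            ((hiso' x hx _ hSZ hxc hSx).1 hxS) fun z hz hlt' => not_lt.1 fun h2 => ?_
          obtain ⟨w, ⟨hw, hw1, hw2⟩, rfl⟩ := (him' z).1
            ⟨hz, hD.c₁_le z hz, h2.trans (hlt _ hSZ hSx).2.2⟩
          have h1 := (hiso' x hx w hw hxc hw1).2 hlt'
          exact ((hiso' w hw _ hSZ hw1 hSx).2 h2).not_ge (hD.S_le x hx w hw h1)
    · rw [hD.S_of_notMem x hx, hfn x hx, hD.S_of_notMem x hx]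
  exact { hD with
    infinite₃₄ := h.models₀.infinite₃₄
    f_mem := hfZ
    f_of_notMem := hfn
    g_f := h.g_f
    f_g := h.f_g
    f_S := hfS
    f_c₁ := hfc₁
    f_c₂ := hfc₂
    c₃_le_f := fun z hz hzc => (hle z hz hzc).2.1
    f_lt_f_of_le := fun x hx z hz hzc hxz => (hiso x hx z hz (hxz.le.trans hzc) hzc).1 hxz
    f_lt_f_of_lt := fun x hx z hz hxc hxz => (hiso' x hx z hz hxc (hxc.trans hxz)).1 hxz
    circular := fun n z hz => h.circular (n + 2) 1 (by lia) one_pos z hz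
    infinite_forward := h.infinite_forward
    infinite_backward := h.infinite_backward }

theorem ModelsT₁.isDefective {M : Type u} {𝓜 : L₁.Structure M} (h : ModelsT₁ 𝓜) :
    letI := h.models₀.dlo.linearOrder; (rotationData (modified 𝓜)).IsDefective := by
  let := h.models₀.dlo.linearOrder
  exact h.isRotation.isDefective_modify

/-! ### Back-and-forth between models. -/

open DefectiveRotation

/-- The interpretations of the symbols of `L₁` form a dense linear order with a defective
rotation. -/
structure ModelsDefective {M : Type u} (𝓜 : L₁.Structure M) : Prop where
  dlo : IsDLO (reduct₀ 𝓜)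
  isDefective : letI := dlo.linearOrder; (rotationData 𝓜).IsDefective

theorem ModelsT₁.modelsDefective {M : Type u} {𝓜 : L₁.Structure M} (h : ModelsT₁ 𝓜) :
    ModelsDefective (modified 𝓜) :=
  ⟨h.models₀.dlo, h.isDefective⟩

theorem ModelsDefective.transfer {M : Type u} {N : Type v} [𝓜 : L₁.Structure M]
    [𝓝 : L₁.Structure N] (h : ModelsDefective 𝓜) (hN : ∀ σ : L₁.Sentence, M ⊨ σ → N ⊨ σ) :
    ModelsDefective 𝓝 :=
  ⟨h.dlo.transfer hN, isDefective_transfer h.dlo (h.dlo.transfer hN) h.isDefective hN⟩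

/-- The defective rotation given by the interpretations of the symbols of `L₁`. -/
def ModelsDefective.rotation {M : Type u} {𝓜 : L₁.Structure M} (h : ModelsDefective 𝓜) :
    letI := h.dlo.linearOrder; DefectiveRotation M :=
  letI := h.dlo.linearOrder
  { rotationData 𝓜, h.isDefective with }

/-- A correspondence between substructures of models that preserves and reflects the
relations. -/
def IsPartialIso {M : Type u} {N : Type v} {𝓜 : L₁.Structure M} {𝓝 : L₁.Structure N}
    (hM : ModelsDefective 𝓜) (hN : ModelsDefective 𝓝) (R : M → N → Prop) : Prop :=
  letI := hM.dlo.linearOrder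
  letI := hN.dlo.linearOrder
  PartialIso hM.rotation hN.rotation R

theorem eq_vec_one {K : Type*} (a : Fin 1 → K) : a = ![a 0] := by
  ext i
  fin_cases i
  rfl

namespace IsPartialIso

section

variable {M : Type u} {N : Type v} {𝓜 : L₁.Structure M} {𝓝 : L₁.Structure N}
  {hM : ModelsDefective 𝓜} {hN : ModelsDefective 𝓝} {R : M → N → Prop}

theorem symm (hR : IsPartialIso hM hN R) : IsPartialIso hN hM fun b a => R a b :=
  let := hM.dlo.linearOrder
  let := hN.dlo.linearOrder
  PartialIso.symm hR

theorem funMap (hR : IsPartialIso hM hN R) {n : ℕ} (F : L₁.Functions n) {a : Fin n → M}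
    {b : Fin n → N} (hab : ∀ i, R (a i) (b i)) :
    R (Structure.funMap F a) (Structure.funMap F b) := by
  let := hM.dlo.linearOrder
  let := hN.dlo.linearOrder
  rcases F with F | F <;> cases F
  · rw [Subsingleton.elim a (![]), Subsingleton.elim b (![])]; exact PartialIso.c₁ hR
  · rw [Subsingleton.elim a (![]), Subsingleton.elim b (![])]; exact PartialIso.c₂ hR
  · rw [Subsingleton.elim a (![]), Subsingleton.elim b (![])]; exact PartialIso.c₃ hR
  · rw [Subsingleton.elim a (![]), Subsingleton.elim b (![])]; exact PartialIso.c₄ hR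
  · rw [eq_vec_one a, eq_vec_one b]; exact PartialIso.S hR (hab 0)
  · rw [eq_vec_one a, eq_vec_one b]; exact PartialIso.P hR (hab 0)
  · rw [eq_vec_one a, eq_vec_one b]; exact PartialIso.π hR (hab 0)
  · rw [eq_vec_one a, eq_vec_one b]; exact PartialIso.f hR (hab 0)
  · rw [eq_vec_one a, eq_vec_one b]; exact PartialIso.g hR (hab 0)

theorem realize_term (hR : IsPartialIso hM hN R) {α : Type*} {v : α → M} {w : α → N}
    (hvw : ∀ i, R (v i) (w i)) (t : L₁.Term α) : R (t.realize v) (t.realize w) := by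
  induction t with
  | var i => exact hvw i
  | func F ts ih => exact hR.funMap F ih

theorem eq_iff (hR : IsPartialIso hM hN R) {a b a' b'} (hab : R a b) (hab' : R a' b') :
    a = a' ↔ b = b' :=
  let := hM.dlo.linearOrder
  let := hN.dlo.linearOrder
  PartialIso.eq_iff hR hab hab'

theorem relMap (hR : IsPartialIso hM hN R) {n : ℕ} (r : L₁.Relations n) {a : Fin n → M}
    {b : Fin n → N} (hab : ∀ i, R (a i) (b i)) :
    Structure.RelMap r a ↔ Structure.RelMap r b := by
  let := hM.dlo.linearOrder
  let := hN.dlo.linearOrder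
  rcases r with r | r <;> cases r
  · rw [eq_vec_one a, eq_vec_one b]
    exact PartialIso.mem_iff hR (hab 0)
  · have h1 : a = ![a 0, a 1] := by ext i; fin_cases i <;> rfl
    have h2 : b = ![b 0, b 1] := by ext i; fin_cases i <;> rfl
    rw [h1, h2]
    exact PartialIso.lt_iff hR (hab 0) (hab 1)

end

section

variable {M : Type u} {N N' : Type v} {𝓜 : L₁.Structure M} [𝓝 : L₁.Structure N]
  [𝓝' : L₁.Structure N'] {hM : ModelsDefective 𝓜} {hN : ModelsDefective 𝓝}
  {hN' : ModelsDefective 𝓝'} {R : M → N → Prop}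

theorem lt_map_iff (j : N ↪ₑ[L₁] N') (a b : N) :
    lt (reduct₀ 𝓝') (j a) (j b) ↔ lt (reduct₀ 𝓝) a b := by
  have := j.map_formula (ltFormula (.var (.inl 0)) (.var (.inl 1)) : L₁.Formula (Fin 2)) ![a, b]
  simp only [Formula.Realize, realize_ltFormula] at this
  exact this

theorem map_mem_iff (j : N ↪ₑ[L₁] N') (a : N) :
    j a ∈ Z (reduct₀ 𝓝') ↔ a ∈ Z (reduct₀ 𝓝) := by
  have := j.map_formula (ZFormula (.var (.inl 0)) : L₁.Formula (Fin 1)) ![a]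
  simp only [Formula.Realize, realize_ZFormula] at this
  exact this

/-- A partial isomorphism stays one after an elementary extension of its codomain. -/
theorem comp_elementaryEmbedding (hR : IsPartialIso hM hN R) (j : N ↪ₑ[L₁] N') :
    IsPartialIso hM hN' fun a b' => ∃ b, R a b ∧ j b = b' := by
  let := hM.dlo.linearOrder
  let := hN.dlo.linearOrder
  let := hN'.dlo.linearOrder
  have hc : ∀ (F : L₁.Functions 0), j (Structure.funMap F ![]) = Structure.funMap F ![] :=
    fun F => (j.map_fun F ![]).trans (congrArg _ (Subsingleton.elim _ _))
  have hf : ∀ (F : L₁.Functions 1) (b : N),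
      j (Structure.funMap F ![b]) = Structure.funMap F ![j b] := fun F b => by
    refine (j.map_fun F ![b]).trans (congrArg _ ?_)
    ext i
    fin_cases i
    rfl
  constructor
  case lt_iff =>
    rintro a _ a' _ ⟨b, hab, rfl⟩ ⟨b', hab', rfl⟩
    exact (PartialIso.lt_iff hR hab hab').trans (lt_map_iff j b b').symm
  case mem_iff =>
    rintro a _ ⟨b, hab, rfl⟩
    exact (PartialIso.mem_iff hR hab).trans (map_mem_iff j b).symm
  case c₁ => exact ⟨_, PartialIso.c₁ hR, hc _⟩
  case c₂ => exact ⟨_, PartialIso.c₂ hR, hc _⟩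
  case c₃ => exact ⟨_, PartialIso.c₃ hR, hc _⟩
  case c₄ => exact ⟨_, PartialIso.c₄ hR, hc _⟩
  case S => rintro a _ ⟨b, hab, rfl⟩; exact ⟨_, PartialIso.S hR hab, hf _ _⟩
  case P => rintro a _ ⟨b, hab, rfl⟩; exact ⟨_, PartialIso.P hR hab, hf _ _⟩
  case π => rintro a _ ⟨b, hab, rfl⟩; exact ⟨_, PartialIso.π hR hab, hf _ _⟩
  case f => rintro a _ ⟨b, hab, rfl⟩; exact ⟨_, PartialIso.f hR hab, hf _ _⟩
  case g => rintro a _ ⟨b, hab, rfl⟩; exact ⟨_, PartialIso.g hR hab, hf _ _⟩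

end

/-- A limit of elements that realize the finite parts of a cut realizes the cut in an elementary
extension. -/
theorem exists_realize_cut {N : Type u} [𝓝 : L₁.Structure N] (hN : ModelsDefective 𝓝)
    (y : Finset N → N) :
    ∃ (N' : Type u) (𝓝' : L₁.Structure N') (j : N ↪ₑ[L₁] N') (_ : ModelsDefective 𝓝') (y' : N'),
      ((∀ F, y F ∈ Z (reduct₀ 𝓝)) → y' ∈ Z (reduct₀ 𝓝')) ∧
      (∀ b, (∀ F, b ∈ F → lt (reduct₀ 𝓝) b (y F)) → lt (reduct₀ 𝓝') (j b) y') ∧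
      (∀ b, (∀ F, b ∈ F → lt (reduct₀ 𝓝) (y F) b) → lt (reduct₀ 𝓝') y' (j b)) := by
  have : Nonempty N := ⟨c₁ (reduct₀ 𝓝)⟩
  obtain ⟨N', 𝓝', j, y', h⟩ := exists_elementaryEmbedding_realize (L := L₁) y
  refine ⟨N', 𝓝', j, hN.transfer fun σ hσ => (j.map_sentence σ).1 hσ, y',
    fun hy => ?_, fun b hb => ?_, fun b hb => ?_⟩
  · have := h (ZFormula (.var (.inl 1))) (c₁ (reduct₀ 𝓝)) ⟨∅, fun F _ => by
      simp only [Formula.Realize, realize_ZFormula]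
      exact hy F⟩
    simp only [Formula.Realize, realize_ZFormula] at this
    exact this
  · have := h (ltFormula (.var (.inl 0)) (.var (.inl 1))) b ⟨{b}, fun F hF => by
      simp only [Formula.Realize, realize_ltFormula]
      exact hb F (hF (Finset.mem_singleton_self b))⟩
    simp only [Formula.Realize, realize_ltFormula] at this
    exact this
  · have := h (ltFormula (.var (.inl 1)) (.var (.inl 0))) b ⟨{b}, fun F hF => by
      simp only [Formula.Realize, realize_ltFormula]
      exact hb F (hF (Finset.mem_singleton_self b))⟩
    simp only [Formula.Realize, realize_ltFormula] at this
    exact this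

section

variable {M : Type u} {N : Type v} {𝓜 : L₁.Structure M} [𝓝 : L₁.Structure N]
  {hM : ModelsDefective 𝓜} {hN : ModelsDefective 𝓝} {R : M → N → Prop}

/-- The cut of `x` is finitely satisfiable in `Z`, so a limit of approximations realizes it. The
strict inequalities keep this limit outside the old range, so it is generic. -/
theorem exists_extension_of_mem (hR : IsPartialIso hM hN R) {x : M} (hx : x ∈ Z (reduct₀ 𝓜)) :
    ∃ (N' : Type v) (𝓝' : L₁.Structure N') (j : N ↪ₑ[L₁] N') (hN' : ModelsDefective 𝓝')
      (R' : M → N' → Prop), IsPartialIso hM hN' R' ∧ (∀ a b, R a b → R' a (j b)) ∧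
        ∃ y, R' x y := by
  by_cases hxR : ∃ b, R x b
  · exact ⟨N, 𝓝, .refl L₁ N, hN, R, hR, fun _ _ h => h, hxR⟩
  let := hM.dlo.linearOrder
  let := hN.dlo.linearOrder
  let u : hM.rotation.Generic {a | ∃ b, R a b} := ⟨x, hx, hxR⟩
  choose y hyZ hy using PartialIso.exists_mem_between hR u
  obtain ⟨N', 𝓝', j, hN', y', h1, h2, h3⟩ := exists_realize_cut hN y
  let := hN'.dlo.linearOrder
  have hR' := hR.comp_elementaryEmbedding (hN' := hN') j
  have hy'Z := h1 hyZ
  have hlt : ∀ a b, R a b → a ∈ hM.rotation.Z → x < a → y' < j b := fun a b hab ha hxa =>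
    h3 b fun F hF => (hy F a b hab ha hF).1 hxa
  have hgt : ∀ a b, R a b → a ∈ hM.rotation.Z → a < x → j b < y' := fun a b hab ha hxa =>
    h2 b fun F hF => (hy F a b hab ha hF).2 hxa
  have hne : ∀ a b, R a b → x ≠ a := fun a b hab e => hxR ⟨b, e ▸ hab⟩
  let w : hN'.rotation.Generic {b' | ∃ a, ∃ b, R a b ∧ j b = b'} := ⟨y', hy'Z, by
    rintro ⟨a, b, hab, e⟩
    have ha : a ∈ hM.rotation.Z := (PartialIso.mem_iff hR hab).2 ((map_mem_iff j b).1 (e ▸ hy'Z))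
    rcases lt_or_gt_of_ne (hne a b hab) with h | h
    · exact (hlt a b hab ha h).ne e.symm
    · exact (hgt a b hab ha h).ne e⟩
  let u' : hM.rotation.Generic {a | ∃ b', ∃ b, R a b ∧ j b = b'} := ⟨x, hx, by
    rintro ⟨_, b, hab, -⟩
    exact hxR ⟨b, hab⟩⟩
  have hcut : SameCut (A := hM.rotation) (B := hN'.rotation)
      (fun a b' => ∃ b, R a b ∧ j b = b') u' w := by
    rintro a _ ⟨b, hab, rfl⟩ ha
    refine ⟨hlt a b hab ha, fun h => ?_⟩
    rcases lt_or_gt_of_ne (hne a b hab) with h' | h'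
    · exact h'
    · exact ((hgt a b hab ha h').not_gt h).elim
  obtain ⟨R', hR', hRR', hxy⟩ := hcut.exists_partialIso hR'
  exact ⟨N', 𝓝', j, hN', R', hR', fun a b hab => hRR' a _ ⟨b, hab, rfl⟩, y', hxy⟩

/-- Any point can be added to the domain of a partial isomorphism, after an elementary extension
of the codomain. -/
theorem exists_extension (hR : IsPartialIso hM hN R) (x : M) :
    ∃ (N' : Type v) (𝓝' : L₁.Structure N') (j : N ↪ₑ[L₁] N') (hN' : ModelsDefective 𝓝')
      (R' : M → N' → Prop), IsPartialIso hM hN' R' ∧ (∀ a b, R a b → R' a (j b)) ∧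
        ∃ y, R' x y := by
  by_cases hx : x ∈ Z (reduct₀ 𝓜)
  · exact hR.exists_extension_of_mem hx
  -- With `π x` already in the domain, `x` can be adjoined without any further new point.
  obtain ⟨N₁, 𝓝₁, j₁, hN₁, R₁, hR₁, hRR₁, q, hq⟩ := hR.exists_extension_of_mem
    (x := π (reduct₀ 𝓜) x) (let := hM.dlo.linearOrder; hM.rotation.π_mem x)
  by_cases hxR : ∃ b, R₁ x b
  · exact ⟨N₁, 𝓝₁, j₁, hN₁, R₁, hR₁, hRR₁, hxR⟩
  let := hM.dlo.linearOrder
  let := hN₁.dlo.linearOrder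
  have : DenselyOrdered N₁ := ⟨hN₁.dlo.dense⟩
  have : NoMinOrder N₁ := ⟨hN₁.dlo.no_min⟩
  have : NoMaxOrder N₁ := ⟨hN₁.dlo.no_max⟩
  choose y hy using PartialIso.exists_between hR₁ x
  obtain ⟨N', 𝓝', j, hN', y', -, h2, h3⟩ := exists_realize_cut hN₁ y
  let := hN'.dlo.linearOrder
  have hR' := hR₁.comp_elementaryEmbedding (hN' := hN') j
  have hlt : ∀ a b, R₁ a b → x < a → y' < j b := fun a b hab hxa =>
    h3 b fun F hF => (hy F a b hab hF).1 hxa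
  have hgt : ∀ a b, R₁ a b → a < x → j b < y' := fun a b hab hxa =>
    h2 b fun F hF => (hy F a b hab hF).2 hxa
  have hne : ∀ a b, R₁ a b → x ≠ a := fun a b hab e => hxR ⟨b, e ▸ hab⟩
  obtain ⟨R', hR', hRR', hxy⟩ := PartialIso.exists_partialIso_of_notMem hR' (x := x)
    (y := y') hx rfl ⟨q, hq, rfl⟩ (by
      rintro a ⟨b, hab, e⟩
      rcases lt_or_gt_of_ne (hne a b hab) with h | h
      · exact (hlt a b hab h).ne e.symm
      · exact (hgt a b hab h).ne e) (by
      rintro a _ ⟨b, hab, rfl⟩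
      refine ⟨hlt a b hab, fun h => ?_⟩
      rcases lt_or_gt_of_ne (hne a b hab) with h' | h'
      · exact h'
      · exact ((hgt a b hab h').not_gt h).elim) (by
      rintro a _ ⟨b, hab, rfl⟩
      refine ⟨hgt a b hab, fun h => ?_⟩
      rcases lt_or_gt_of_ne (hne a b hab) with h' | h'
      · exact ((hlt a b hab h').not_gt h).elim
      · exact h')
  exact ⟨N', 𝓝', j.comp j₁, hN', R', hR', fun a b hab => hRR' a _ ⟨_, hRR₁ a b hab, rfl⟩, y', hxy⟩

end

/-- Partial isomorphisms preserve all first-order formulas. -/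
theorem realize_iff {α : Type*} {n : ℕ} (φ : L₁.BoundedFormula α n) :
    ∀ {M N : Type u} {𝓜 : L₁.Structure M} {𝓝 : L₁.Structure N} {hM : ModelsDefective 𝓜}
      {hN : ModelsDefective 𝓝} {R : M → N → Prop}, IsPartialIso hM hN R →
      ∀ {v : α → M} {w : α → N} {xs : Fin n → M} {ys : Fin n → N}, (∀ i, R (v i) (w i)) →
        (∀ i, R (xs i) (ys i)) → (φ.Realize v xs ↔ φ.Realize w ys) := by
  induction φ with
  | falsum => intros; rfl
  | equal t₁ t₂ =>
    intro M N 𝓜 𝓝 hM hN R hR v w xs ys hv hx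
    have h : ∀ i, R (Sum.elim v xs i) (Sum.elim w ys i) := Sum.rec hv hx
    exact hR.eq_iff (hR.realize_term h t₁) (hR.realize_term h t₂)
  | rel r ts =>
    intro M N 𝓜 𝓝 hM hN R hR v w xs ys hv hx
    have h : ∀ i, R (Sum.elim v xs i) (Sum.elim w ys i) := Sum.rec hv hx
    exact hR.relMap r fun i => hR.realize_term h (ts i)
  | imp φ ψ ih₁ ih₂ =>
    intro M N 𝓜 𝓝 hM hN R hR v w xs ys hv hx
    exact imp_congr (ih₁ hR hv hx) (ih₂ hR hv hx)
  | @all k φ ih =>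
    -- By symmetry one direction suffices. Passing to `N'` is harmless: `φ.all` is preserved by the
    -- elementary embedding, and the induction hypothesis covers all models.
    have key : ∀ {M N : Type u} {𝓜 : L₁.Structure M} {𝓝 : L₁.Structure N}
        {hM : ModelsDefective 𝓜} {hN : ModelsDefective 𝓝} {R : M → N → Prop},
        IsPartialIso hM hN R → ∀ {v : α → M} {w : α → N} {xs : Fin k → M} {ys : Fin k → N},
        (∀ i, R (v i) (w i)) → (∀ i, R (xs i) (ys i)) → φ.all.Realize w ys →
          φ.all.Realize v xs := by
      intro M N 𝓜 𝓝 hM hN R hR v w xs ys hv hx h x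
      obtain ⟨N', 𝓝', j, hN', R', hR', hRR', y, hxy⟩ := hR.exists_extension x
      have h' := (j.map_boundedFormula φ.all w ys).2 h y
      refine (ih hR' (fun i => hRR' _ _ (hv i)) fun i => ?_).2 h'
      refine Fin.lastCases ?_ (fun i => ?_) i
      · simpa only [Fin.snoc_last] using hxy
      · simpa only [Fin.snoc_castSucc, Function.comp_apply] using hRR' _ _ (hx i)
    intro M N 𝓜 𝓝 hM hN R hR v w xs ys hv hx
    exact ⟨key hR.symm hv hx, key hR hv hx⟩

/-- Tuples with the same quantifier-free type generate isomorphic substructures. -/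
theorem of_realize_isQF {M : Type u} {N : Type v} {𝓜 : L₁.Structure M} {𝓝 : L₁.Structure N}
    (hM : ModelsDefective 𝓜) (hN : ModelsDefective 𝓝) {n : ℕ} {a : Fin n → M} {b : Fin n → N}
    (h : ∀ ψ : L₁.Formula (Fin n), BoundedFormula.IsQF ψ → (ψ.Realize a ↔ ψ.Realize b)) :
    IsPartialIso hM hN fun x y => ∃ t : L₁.Term (Fin n), t.realize a = x ∧ t.realize b = y := by
  let := hM.dlo.linearOrder
  let := hN.dlo.linearOrder
  constructor
  case lt_iff =>
    rintro _ _ _ _ ⟨t, rfl, rfl⟩ ⟨s, rfl, rfl⟩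
    have := h (ltFormula (t.relabel Sum.inl) (s.relabel Sum.inl))
      (BoundedFormula.IsAtomic.rel _ _).isQF
    simp only [Formula.Realize, realize_ltFormula, Term.realize_relabel,
      Sum.elim_comp_inl] at this
    exact this
  case mem_iff =>
    rintro _ _ ⟨t, rfl, rfl⟩
    have := h (ZFormula (t.relabel Sum.inl)) (BoundedFormula.IsAtomic.rel _ _).isQF
    simp only [Formula.Realize, realize_ZFormula, Term.realize_relabel,
      Sum.elim_comp_inl] at this
    exact this
  case c₁ => exact ⟨c₁Term, realize_c₁Term _, realize_c₁Term _⟩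
  case c₂ => exact ⟨c₂Term, realize_c₂Term _, realize_c₂Term _⟩
  case c₃ => exact ⟨c₃Term, realize_c₃Term _, realize_c₃Term _⟩
  case c₄ => exact ⟨c₄Term, realize_c₄Term _, realize_c₄Term _⟩
  case S =>
    rintro _ _ ⟨t, rfl, rfl⟩
    exact ⟨STerm t, realize_STerm _ _, realize_STerm _ _⟩
  case P =>
    rintro _ _ ⟨t, rfl, rfl⟩
    exact ⟨PTerm t, realize_PTerm _ _, realize_PTerm _ _⟩
  case π =>
    rintro _ _ ⟨t, rfl, rfl⟩
    exact ⟨πTerm t, realize_πTerm _ _, realize_πTerm _ _⟩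
  case f =>
    rintro _ _ ⟨t, rfl, rfl⟩
    exact ⟨fTerm t, realize_fTerm _ _, realize_fTerm _ _⟩
  case g =>
    rintro _ _ ⟨t, rfl, rfl⟩
    exact ⟨gTerm t, realize_gTerm _ _, realize_gTerm _ _⟩

end IsPartialIso

/-- The complete theory of a model with a defective rotation admits quantifier elimination. -/
theorem ModelsDefective.admitsQE {M : Type u} {𝓜 : L₁.Structure M} (h : ModelsDefective 𝓜) :
    AdmitsQE (L₁.completeTheory M) := by
  -- These models live in `Type`, while `M` may live in any universe; hence the transfer across
  -- universes.
  have hmodel : ∀ N : Theory.ModelType.{0, 0, 0} (L₁.completeTheory M),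
      ModelsDefective (N.struc : L₁.Structure N) := fun N =>
    h.transfer fun σ hσ => Theory.realize_sentence_of_mem (L₁.completeTheory M) hσ
  refine admitsQE_of_realize fun n φ N₁ N₂ a b hab hφ => ?_
  refine ((IsPartialIso.of_realize_isQF (hmodel N₁) (hmodel N₂) hab).realize_iff φ
    (fun i => ⟨.var i, rfl, rfl⟩) fun i => i.elim0).1 hφ

end PseudoOMin

theorem mainTheorem3 {M : Type*} (𝓜₁ : PseudoOMin.L₁.Structure M)
    (h : PseudoOMin.ModelsT₁ 𝓜₁) :
    PseudoOMin.AdmitsQE (PseudoOMin.T₂ 𝓜₁) ∧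
    Set.MapsTo (PseudoOMin.f (PseudoOMin.modified 𝓜₁))
      (PseudoOMin.Z (PseudoOMin.reduct₀ (PseudoOMin.modified 𝓜₁)))
      (PseudoOMin.Z (PseudoOMin.reduct₀ (PseudoOMin.modified 𝓜₁))) ∧
    Set.InjOn (PseudoOMin.f (PseudoOMin.modified 𝓜₁))
      (PseudoOMin.Z (PseudoOMin.reduct₀ (PseudoOMin.modified 𝓜₁))) ∧
    ¬ Set.SurjOn (PseudoOMin.f (PseudoOMin.modified 𝓜₁))
      (PseudoOMin.Z (PseudoOMin.reduct₀ (PseudoOMin.modified 𝓜₁)))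
      (PseudoOMin.Z (PseudoOMin.reduct₀ (PseudoOMin.modified 𝓜₁))) := by
  have hM := h.modelsDefective
  let := hM.dlo.linearOrder
  let A := hM.rotation
  refine ⟨hM.admitsQE, A.f_mem, (Function.LeftInverse.injective A.g_f).injOn, fun hsurj => ?_⟩
  -- `P c₃` has no preimage in `Z`: points up to `c₂` have values at least `c₃`, and points beyond
  -- it have values below `P c₃`.
  obtain ⟨z, hz, e⟩ := hsurj (A.P_mem A.c₃_mem)
  have e : A.f z = A.P A.c₃ := e
  rcases le_or_gt z A.c₂ with h' | h'
  · exact (A.c₃_le_f z hz h').not_gt (e ▸ A.P_c₃_lt)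
  · exact (A.f_lt z hz h').ne e
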